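/- Let $N\ge 1$ and let $(\Omega,\mathcal F,\mathbb P)$ be a probability space carrying i.i.d. real random variables $U_1,U_2,\dots\ge 0$ (loss amounts) and i.i.d. random variables $\tau_1,\tau_2,\dots$ with values in $\{1,\dots,N\}$ almost surely (default times), the two sequences being independent of each other. Put $p_j=\mathbb P(\tau_1=j)$ for $1\le j\le N$ (so $\sum_j p_j=1$; some $p_j$ may vanish), and let $L_n(t)=\sum_{k=1}^n U_k 1_{\{\tau_k\le t\}}$. Write $\Lambda_U(\theta)=\log\mathbb E\,e^{\theta U_1}\in(-\infty,\infty]$ and $\Lambda_U^\star(x)=\sup_{\theta\in\mathbb R}(\theta x-\Lambda_U(\theta))$. Let $\Phi=\{\varphi\in\mathbb R^N:\varphi_i\ge 0,\ \sum_{i=1}^N\varphi_i=1\}$, and let $\mathbb R^N_\le=\{x\in\mathbb R^N: 0\le x_1\le\dots\le x_N\}$ carry the topology of the supremum norm. Assume the following. For all $\varphi\in\Phi$ and all sequences $(\varphi^n)$ in $\Phi$ with $\varphi^n\to\varphi$, with $\psi_i=\sum_{j\le i}\varphi_j$ and $\psi^n_i=\sum_{j\le i}\varphi^n_j$, the laws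 $\mu_n$ of $\bigl(\frac1n\sum_{k=1}^{\lfloor n\psi_i\rfloor}U_k\bigr)_{i=1}^N$ and $\nu_n$ of $\bigl(\frac1n\sum_{k=1}^{\lfloor n\psi^n_i\rfloor}U_k\bigr)_{i=1}^N$ are exponentially equivalent on $(\mathbb R^N,\|\cdot\|_\infty)$; that is, for each $n$ there are random vectors $Y_n\sim\mu_n$ and $Z_n\sim\nu_n$ on a common probability space such that $\limsup_{n\to\infty}\frac1n\log\mathbb P(\|Y_n-Z_n\|_\infty\ge\delta)=-\infty$ for every $\delta>0$. Then the average loss process $\bigl(L_n(1)/n,\dots,L_n(N)/n\bigr)$ satisfies the large deviation principle in $\mathbb R^N_\le$ with the rate function $$I_{U,p}(x)=\inf_{\varphi\in\Phi}\ \sum_{i=1}^N\varphi_i\left(\log\frac{\varphi_i}{p_i}+\Lambda_U^\star\!\left(\frac{\Delta x_i}{\varphi_i}\right)\right),\qquad \Delta x_i=x_i-x_{i-1},\quad x_0=0,$$ where a summand with $\varphi_i=0$ is read as $0$ if $\Delta x_i=0$ and as $+\infty$ if $\Delta x_i>0$, and a summand with $p_i=0<\varphi_i$ is read as $+\infty$.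 That is, $I_{U,p}:\mathbb R^N_\le\to[0,\infty]$ is lower semicontinuous, and for every closed $F\subseteq\mathbb R^N_\le$ and every open $G\subseteq\mathbb R^N_\le$ $$\limsup_{n\to\infty}\tfrac1n\log\mathbb P\bigl(L_n(\cdot)/n\in F\bigr)\le-\inf_{x\in F}I_{U,p}(x),\qquad \liminf_{n\to\infty}\tfrac1n\log\mathbb P\bigl(L_n(\cdot)/n\in G\bigr)\ge-\inf_{x\in G}I_{U,p}(x).$$ -/

import Mathlib

open MeasureTheory ProbabilityTheory Filter Topology
open scoped ENNReal

noncomputable section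

namespace LossLDP

/-! ### Large deviations -/

/-- A rate function: a lower semicontinuous function with values in `[0, ∞]`. -/
structure IsRateFunction {X : Type*} [TopologicalSpace X] (I : X → EReal) : Prop where
  nonneg : ∀ x, 0 ≤ I x
  lowerSemicontinuous : LowerSemicontinuous I

/-- The large deviation principle, with speed `n`, for a sequence of measures. Logarithms are
extended-real valued, with `log 0 = -∞`. -/
structure SatisfiesLDP {X : Type*} [TopologicalSpace X] [MeasurableSpace X]
    (μ : ℕ → Measure X) (I : X → EReal) : Prop where
  rate : IsRateFunction I
  upper : ∀ F : Set X, IsClosed F →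
    limsup (fun n : ℕ => ENNReal.log (μ n F) / (n : EReal)) atTop ≤ -⨅ x ∈ F, I x
  lower : ∀ G : Set X, IsOpen G →
    -⨅ x ∈ G, I x ≤ liminf (fun n : ℕ => ENNReal.log (μ n G) / (n : EReal)) atTop

/-- Exponential equivalence of two sequences of probability measures on a metric space.
The measure `γ n` is the joint law of the pair `(Y n, Z n)` of random variables with marginal
laws `μ n` and `ν n`. -/
def ExpEquivalent {X : Type*} [PseudoMetricSpace X] [MeasurableSpace X]
    (μ ν : ℕ → Measure X) : Prop :=
  ∃ γ : ℕ → Measure (X × X),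
    (∀ n, (γ n).map Prod.fst = μ n) ∧ (∀ n, (γ n).map Prod.snd = ν n) ∧
    ∀ δ : ℝ, 0 < δ →
      limsup (fun n : ℕ => ENNReal.log (γ n {z | δ ≤ dist z.1 z.2}) / (n : EReal)) atTop = ⊥

/-- The logarithmic moment generating function `θ ↦ log E[exp (θ X)]`, possibly `+∞`. -/
def logMGF {Ω : Type*} [MeasurableSpace Ω] (P : Measure Ω) (X : Ω → ℝ) (θ : ℝ) : EReal :=
  ENNReal.log (∫⁻ ω, ENNReal.ofReal (Real.exp (θ * X ω)) ∂P)

/-- The Fenchel–Legendre transform of the random variable `X`. -/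
def fenchelLegendre {Ω : Type*} [MeasurableSpace Ω] (P : Measure Ω) (X : Ω → ℝ) (x : ℝ) : EReal :=
  ⨆ θ : ℝ, ((θ * x : ℝ) : EReal) - logMGF P X θ

/-! ### Paths on the grid

The grid `{1, …, N}` is indexed by `Fin N`: the index `i` stands for the time `i + 1`. -/

/-- The space of nonnegative nondecreasing paths on `{1, …, N}`, with the topology induced by the
supremum norm. -/
abbrev PathSpace (N : ℕ) : Type :=
  {x : Fin N → ℝ // (∀ i, 0 ≤ x i) ∧ Monotone x}

/-- The increment of a path at the `i`-th grid point; the path starts from the value `0`. -/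
def increment {N : ℕ} (x : Fin N → ℝ) (i : Fin N) : ℝ :=
  x i - if (i : ℕ) = 0 then 0 else x ⟨(i : ℕ) - 1, lt_of_le_of_lt (Nat.sub_le _ _) i.isLt⟩

/-- The cumulative distribution function of a probability vector on the grid. -/
def cumul {N : ℕ} (φ : Fin N → ℝ) (i : Fin N) : ℝ := ∑ j ∈ Finset.Iic i, φ j

/-! ### The loss process

The obligors `1, 2, …` are indexed by `0, 1, …`. -/

/-- The cumulative loss at time `t` of the portfolio of the first `n` obligors. -/
def loss {Ω : Type*} (U : ℕ → Ω → ℝ) (τ : ℕ → Ω → ℕ) (n t : ℕ) (ω : Ω) : ℝ :=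
  ∑ k ∈ Finset.range n, U k ω * if τ k ω ≤ t then 1 else 0

/-- The average loss process on the grid `{1, …, N}`, as a random element of the path space. -/
def avgLossPath {Ω : Type*} (N : ℕ) (U : ℕ → Ω → ℝ) (τ : ℕ → Ω → ℕ)
    (hU : ∀ k ω, 0 ≤ U k ω) (n : ℕ) (ω : Ω) : PathSpace N :=
  ⟨fun i => loss U τ n ((i : ℕ) + 1) ω / n, by
    have key : ∀ s t : ℕ, s ≤ t → loss U τ n s ω ≤ loss U τ n t ω := by
      intro s t hst
      refine Finset.sum_le_sum fun k _ => mul_le_mul_of_nonneg_left ?_ (hU k ω)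
      by_cases h : τ k ω ≤ s
      · simp [h, h.trans hst]
      · simp only [h, if_false]
        split_ifs <;> norm_num
    refine ⟨fun i => div_nonneg (Finset.sum_nonneg fun k _ => mul_nonneg (hU k ω) ?_)
      n.cast_nonneg, fun i j hij => div_le_div_of_nonneg_right (key _ _ ?_) n.cast_nonneg⟩
    · split_ifs <;> norm_num
    · have : (i : ℕ) ≤ j := hij
      lia⟩

/-- The distribution of the default time on the grid. -/
def defaultDist {Ω : Type*} [MeasurableSpace Ω] (P : Measure Ω) (N : ℕ) (τ : Ω → ℕ)
    (i : Fin N) : ℝ≥0∞ :=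
  P {ω | τ ω = (i : ℕ) + 1}

/-- The vector of rounded partial sums `(1/n) ∑_{k ≤ [n ψ_i]} U_k`, `ψ` being the cumulative
distribution function of `φ`. -/
def roundedSums {Ω : Type*} {N : ℕ} (U : ℕ → Ω → ℝ) (φ : Fin N → ℝ) (n : ℕ) (ω : Ω) : Fin N → ℝ :=
  fun i => (∑ k ∈ Finset.range ⌊(n : ℝ) * cumul φ i⌋₊, U k ω) / n

/-- The assumption on the loss amounts: whenever `φ^n → φ` in the simplex, the laws of the rounded
partial sums for `φ` and for `φ^n` are exponentially equivalent on `ℝ^N` with the supremum norm. -/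
def RoundedSumsExpEquivalent {Ω : Type*} [MeasurableSpace Ω] (P : Measure Ω) (N : ℕ)
    (U : ℕ → Ω → ℝ) : Prop :=
  ∀ φ ∈ stdSimplex ℝ (Fin N), ∀ φs : ℕ → Fin N → ℝ, (∀ n, φs n ∈ stdSimplex ℝ (Fin N)) →
    Tendsto φs atTop (𝓝 φ) →
    ExpEquivalent (fun n => P.map (roundedSums U φ n)) (fun n => P.map (roundedSums U (φs n) n))

/-! ### The rate function -/

/-- The summand `φ (log (φ / p) + Λ* (d / φ))`, with the usual conventions: for `φ = 0` it is `0`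
if `d = 0` and `+∞` otherwise; for `p = 0 < φ` it is `+∞`. -/
def rateTerm (Λstar : ℝ → EReal) (p : ℝ≥0∞) (φ d : ℝ) : EReal :=
  if φ = 0 then (if d = 0 then 0 else ⊤)
  else (φ : EReal) * (ENNReal.log (ENNReal.ofReal φ / p) + Λstar (d / φ))

/-- The rate function `I_{U,p}` of the average loss process. -/
def rateFunction {Ω : Type*} [MeasurableSpace Ω] {N : ℕ} (P : Measure Ω) (X : Ω → ℝ)
    (p : Fin N → ℝ≥0∞) (x : PathSpace N) : EReal :=
  ⨅ φ ∈ stdSimplex ℝ (Fin N), ∑ i, rateTerm (fenchelLegendre P X) (p i) (φ i) (increment x.1 i)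

end LossLDP

end

/-!
By Fenchel duality each summand of the rate function is the supremum of the affine functionals
`(φ, d) ↦ η φ + θ d + φ - p exp η E[exp (θ U)]`, the optimal `η` being
`log (φ / p) - log E[exp (θ U)]`.

For the upper bound, the functional with duals `(η_i, θ_i)`, evaluated at the default frequencies
and the path increments, is an empirical mean over the i.i.d. pairs `(U_k, τ_k)`, to which
Chernoff's bound applies. The frequencies live in the compact simplex, so only the path needs
exponential tightness, which one positive exponential moment of `U` provides. For the lower bound,
Cramér's change of measure on each grid point produces a law of the pair under which the increments
have prescribed means, at an exponential cost equal to the summands of the rate function.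

The functionals also describe a summand with `φ_i = 0` once `U` has all exponential moments. For
`N ≥ 2` these come from the exponential equivalence: with `φ_1 = 0` and `φ^n_1 = 1 / n` the rounded
sums differ by `U_1 / n` in the first coordinate. For `N = 1` the only `φ` is `1`, and if `U` has no
positive exponential moment then `Λ*` vanishes at infinity, so a closed set on which the rate
function exceeds a positive level is bounded.
-/

namespace LossLDP

/-! ### Independent pairs -/

section Independence

variable {Ω ι α β : Type*} [MeasurableSpace α] [MeasurableSpace β]

theorem comap_prodMk_eq_generateFrom (X : Ω → α) (Y : Ω → β) :
    MeasurableSpace.comap (fun ω => (X ω, Y ω)) inferInstance = MeasurableSpace.generateFrom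
      {S | ∃ A B, MeasurableSet A ∧ MeasurableSet B ∧ S = X ⁻¹' A ∩ Y ⁻¹' B} := by
  rw [← generateFrom_prod, MeasurableSpace.comap_generateFrom]
  congr 1
  ext S
  constructor
  · rintro ⟨_, ⟨A, hA, B, hB, rfl⟩, rfl⟩
    exact ⟨A, B, hA, hB, rfl⟩
  · rintro ⟨A, B, hA, hB, rfl⟩
    exact ⟨_, ⟨A, hA, B, hB, rfl⟩, rfl⟩

theorem iIndepFun_prodMk [MeasurableSpace Ω] {P : Measure Ω} {X : ι → Ω → α} {Y : ι → Ω → β}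
    (hX : ∀ k, Measurable (X k)) (hY : ∀ k, Measurable (Y k))
    (hXi : iIndepFun X P) (hYi : iIndepFun Y P)
    (hXY : IndepFun (fun ω k => X k ω) (fun ω k => Y k ω) P) :
    iIndepFun (fun k ω => (X k ω, Y k ω)) P := by
  have := hXi.isProbabilityMeasure
  rw [iIndepFun_iff_iIndep]
  refine iIndepSets.iIndep (fun k => ((hX k).prodMk (hY k)).comap_le)
    (fun k => {S | ∃ A B, MeasurableSet A ∧ MeasurableSet B ∧ S = X k ⁻¹' A ∩ Y k ⁻¹' B})
    ?_ (fun k => comap_prodMk_eq_generateFrom (X k) (Y k)) ?_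
  · rintro k _ ⟨A, B, hA, hB, rfl⟩ _ ⟨A', B', hA', hB', rfl⟩ -
    exact ⟨A ∩ A', B ∩ B', hA.inter hA', hB.inter hB', by ext; simp; tauto⟩
  rw [iIndepSets_iff]
  intro s f hf
  choose! A B hA hB hAB using hf
  have hXYk (k : ι) : IndepFun (X k) (Y k) P :=
    hXY.comp (measurable_pi_apply k) (measurable_pi_apply k)
  have hsplit : (⋂ i ∈ s, f i) = (⋂ i ∈ s, X i ⁻¹' A i) ∩ ⋂ i ∈ s, Y i ⁻¹' B i := by
    rw [Set.iInter₂_congr hAB]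
    ext; simp; grind
  have hprod : P ((⋂ i ∈ s, X i ⁻¹' A i) ∩ ⋂ i ∈ s, Y i ⁻¹' B i)
      = P (⋂ i ∈ s, X i ⁻¹' A i) * P (⋂ i ∈ s, Y i ⁻¹' B i) := by
    simpa only [Set.preimage_iInter] using! hXY.measure_inter_preimage_eq_mul
      (⋂ i ∈ s, {v | v i ∈ A i}) (⋂ i ∈ s, {v | v i ∈ B i})
      (s.measurableSet_biInter fun i hi => measurable_pi_apply i (hA i hi))
      (s.measurableSet_biInter fun i hi => measurable_pi_apply i (hB i hi))
  rw [hsplit, hprod, hXi.measure_inter_preimage_eq_mul s hA,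
    hYi.measure_inter_preimage_eq_mul s hB, ← Finset.prod_mul_distrib]
  refine Finset.prod_congr rfl fun i hi => ?_
  rw [hAB i hi, (hXYk i).measure_inter_preimage_eq_mul _ _ (hA i hi) (hB i hi)]

end Independence

/-! ### Exponential bounds for sums of independent variables -/

section ExponentialBounds

open ExpGrowth

theorem ofReal_exp_mul_natCast (a : ℝ) (n : ℕ) :
    ENNReal.ofReal (Real.exp (n * a)) = EReal.exp (a * n) := by
  rw [← EReal.exp_coe, mul_comm, EReal.coe_mul, EReal.coe_natCast]

theorem expGrowthSup_le_of_isCompact {X : Type*} [TopologicalSpace X] [MeasurableSpace X]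
    {μ : ℕ → Measure X} {K : Set X} (hK : IsCompact K) {c : EReal}
    (h : ∀ x ∈ K, ∃ S ∈ 𝓝 x, expGrowthSup (fun n => μ n S) ≤ c) :
    expGrowthSup (fun n => μ n K) ≤ c := by
  refine hK.induction_on (p := fun S => expGrowthSup (fun n => μ n S) ≤ c) ?_ ?_ ?_ ?_
  · simp only [measure_empty]
    exact expGrowthSup_zero.trans_le bot_le
  · exact fun S T hST hT =>
      (expGrowthSup_monotone fun n => measure_mono hST).trans hT
  · intro S T hS hT
    calc expGrowthSup (fun n => μ n (S ∪ T))
        ≤ expGrowthSup ((fun n => μ n S) + fun n => μ n T) :=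
          expGrowthSup_monotone fun n => measure_union_le S T
      _ = expGrowthSup (fun n => μ n S) ⊔ expGrowthSup (fun n => μ n T) := expGrowthSup_add
      _ ≤ c := sup_le hS hT
  · intro x hx
    obtain ⟨S, hS, hSc⟩ := h x hx
    exact ⟨S, mem_nhdsWithin_of_mem_nhds hS, hSc⟩

variable {Ω E : Type*} [MeasurableSpace Ω] [MeasurableSpace E] {P : Measure Ω}
  {V : ℕ → Ω → E}

theorem lintegral_ofReal_exp_sum (hV : ∀ k, Measurable (V k)) (hVi : iIndepFun V P)
    (hVd : ∀ k, IdentDistrib (V k) (V 0) P P) {f : E → ℝ} (hf : Measurable f) (n : ℕ) :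
    ∫⁻ ω, ENNReal.ofReal (Real.exp (∑ k ∈ Finset.range n, f (V k ω))) ∂P
      = (∫⁻ ω, ENNReal.ofReal (Real.exp (f (V 0 ω))) ∂P) ^ n := by
  have hg : Measurable fun e => ENNReal.ofReal (Real.exp (f e)) := by fun_prop
  calc ∫⁻ ω, ENNReal.ofReal (Real.exp (∑ k ∈ Finset.range n, f (V k ω))) ∂P
      = ∫⁻ ω, ∏ k ∈ Finset.range n, ENNReal.ofReal (Real.exp (f (V k ω))) ∂P := by
        simp_rw [Real.exp_sum, ENNReal.ofReal_prod_of_nonneg fun _ _ => (Real.exp_pos _).le]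
    _ = ∏ k ∈ Finset.range n, ∫⁻ ω, ENNReal.ofReal (Real.exp (f (V k ω))) ∂P :=
        lintegral_prod_eq_prod_lintegral_of_indepFun _ _ (hVi.comp _ fun _ => hg)
          fun k => hg.comp (hV k)
    _ = (∫⁻ ω, ENNReal.ofReal (Real.exp (f (V 0 ω))) ∂P) ^ n := by
        simpa using Finset.prod_congr rfl fun k (_ : k ∈ Finset.range n) =>
          ((hVd k).comp hg).lintegral_eq

/-- Unlike the optimal `log Q`, the exponent `Q - 1` is additive over a splitting of the law of
`V 0`. -/
theorem expGrowthSup_measure_le_sum_le (hV : ∀ k, Measurable (V k)) (hVi : iIndepFun V P)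
    (hVd : ∀ k, IdentDistrib (V k) (V 0) P P) {f : E → ℝ} (hf : Measurable f) {Q : ℝ≥0∞}
    (hQ : ∫⁻ ω, ENNReal.ofReal (Real.exp (f (V 0 ω))) ∂P = Q) (hQt : Q ≠ ⊤) (a : ℝ) :
    expGrowthSup (fun n => P {ω | n * a ≤ ∑ k ∈ Finset.range n, f (V k ω)})
      ≤ (Q.toReal - 1 - a : ℝ) := by
  refine Eventually.expGrowthSup_le (Eventually.of_forall fun n => ?_)
  rw [← ofReal_exp_mul_natCast]
  have : Measurable fun ω => ∑ k ∈ Finset.range n, f (V k ω) :=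
    Finset.measurable_sum _ fun k _ => hf.comp (hV k)
  have hpow : Q ^ n ≤ ENNReal.ofReal (Real.exp (n * (Q.toReal - 1))) := by
    conv_lhs => rw [← ENNReal.ofReal_toReal hQt]
    rw [← ENNReal.ofReal_pow ENNReal.toReal_nonneg, Real.exp_nat_mul]
    gcongr
    linarith [Real.add_one_le_exp (Q.toReal - 1)]
  calc P {ω | n * a ≤ ∑ k ∈ Finset.range n, f (V k ω)}
      ≤ (∫⁻ ω, ENNReal.ofReal (Real.exp (∑ k ∈ Finset.range n, f (V k ω))) ∂P)
          / ENNReal.ofReal (Real.exp (n * a)) := by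
        refine (measure_mono fun ω hω => ?_).trans
          (meas_ge_le_lintegral_div (by fun_prop) (by simp [Real.exp_pos]) ENNReal.ofReal_ne_top)
        exact ENNReal.ofReal_le_ofReal (Real.exp_le_exp.2 hω)
    _ ≤ ENNReal.ofReal (Real.exp (n * (Q.toReal - 1))) / ENNReal.ofReal (Real.exp (n * a)) := by
        rw [lintegral_ofReal_exp_sum hV hVi hVd hf, hQ]
        gcongr
    _ = ENNReal.ofReal (Real.exp (n * (Q.toReal - 1 - a))) := by
        rw [← ENNReal.ofReal_div_of_pos (Real.exp_pos _), ← Real.exp_sub, mul_sub (n : ℝ) _ a]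

theorem measurableSet_average_near {ι κ : Type*} [Countable ι] {W : κ → Ω → E}
    (hW : ∀ k, Measurable (W k)) {Y : ι → E → ℝ} (hY : ∀ i, Measurable (Y i)) (s : Finset κ)
    (n : ℕ) (m : ι → ℝ) (δ : ℝ) :
    MeasurableSet {ω | ∀ i, |(∑ k ∈ s, Y i (W k ω)) / n - m i| < δ} := by
  rw [Set.ofPred_forall]
  have := fun i k => (hY i).comp (hW k)
  exact .iInter fun i => measurableSet_lt (by fun_prop) measurable_const

theorem tendsto_measure_average_near [IsProbabilityMeasure P] {ι : Type*} [Finite ι]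
    (hV : ∀ k, Measurable (V k)) (hVi : iIndepFun V P)
    (hVd : ∀ k, IdentDistrib (V k) (V 0) P P) {Y : ι → E → ℝ} (hY : ∀ i, Measurable (Y i))
    (hYint : ∀ i, Integrable (Y i) (P.map (V 0))) {δ : ℝ} (hδ : 0 < δ) :
    Tendsto (fun n : ℕ => P {ω | ∀ i, |(∑ k ∈ Finset.range n, Y i (V k ω)) / n
      - ∫ e, Y i e ∂P.map (V 0)| < δ}) atTop (𝓝 1) := by
  have hslln : ∀ᵐ ω ∂P, ∀ i, Tendsto (fun n : ℕ => (∑ k ∈ Finset.range n, Y i (V k ω)) / n)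
      atTop (𝓝 (∫ e, Y i e ∂P.map (V 0))) := by
    refine ae_all_iff.2 fun i => ?_
    rw [integral_map (hV 0).aemeasurable (hY i).aestronglyMeasurable]
    exact strong_law_ae_real (fun k ω => Y i (V k ω))
      ((integrable_map_measure (hY i).aestronglyMeasurable (hV 0).aemeasurable).1 (hYint i))
      (fun j k hjk => (hVi.indepFun hjk).comp (hY i) (hY i)) fun k => (hVd k).comp (hY i)
  rw [← measure_univ (μ := P)]
  refine tendsto_measure_of_ae_tendsto_indicator_of_isFiniteMeasure atTop .univ
    (fun n => measurableSet_average_near hV hY _ n _ δ) ?_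
  filter_upwards [hslln] with ω hω
  filter_upwards [eventually_all.2 fun i => Metric.tendsto_nhds.1 (hω i) δ hδ] with n hn
  simpa [Real.dist_eq] using hn

end ExponentialBounds

/-! ### Change of measure for independent samples -/

section ChangeOfMeasure

open ExpGrowth

theorem pi_mono {ι : Type*} [Fintype ι] {α : ι → Type*} [∀ i, MeasurableSpace (α i)]
    {μ ν : ∀ i, Measure (α i)} (h : ∀ i, μ i ≤ ν i) : Measure.pi μ ≤ Measure.pi ν := by
  refine Measure.le_iff.2 fun S hS => ?_
  rw [Measure.pi, Measure.pi, toMeasure_apply _ _ hS, toMeasure_apply _ _ hS]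
  refine OuterMeasure.le_pi.2 (fun s _ => ?_) S
  exact (OuterMeasure.pi_pi_le _ s).trans (Finset.prod_le_prod' fun i _ => h i (s i))

theorem lintegral_pi_prod {ι : Type*} [Fintype ι] {α : ι → Type*} [∀ i, MeasurableSpace (α i)]
    {μ : ∀ i, Measure (α i)} [∀ i, IsProbabilityMeasure (μ i)] {f : ∀ i, α i → ℝ≥0∞}
    (hf : ∀ i, Measurable (f i)) :
    ∫⁻ v, ∏ i, f i (v i) ∂Measure.pi μ = ∏ i, ∫⁻ x, f i x ∂μ i := by
  rw [lintegral_prod_eq_prod_lintegral_of_indepFun Finset.univ (fun i (v : ∀ i, α i) => f i (v i))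
    (iIndepFun_pi fun i => (hf i).aemeasurable) fun i => (hf i).comp (measurable_pi_apply i)]
  exact Finset.prod_congr rfl fun i _ => (measurePreserving_eval μ i).lintegral_comp (hf i)

theorem pi_withDensity {ι : Type*} [Fintype ι] {α : ι → Type*} [∀ i, MeasurableSpace (α i)]
    {μ : ∀ i, Measure (α i)} [∀ i, IsProbabilityMeasure (μ i)] {f : ∀ i, α i → ℝ≥0∞}
    [∀ i, SigmaFinite ((μ i).withDensity (f i))] (hf : ∀ i, Measurable (f i)) :
    Measure.pi (fun i => (μ i).withDensity (f i))
      = (Measure.pi μ).withDensity fun v => ∏ i, f i (v i) := by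
  refine Measure.pi_eq fun s hs => ?_
  have hind (v : ∀ i, α i) : (Set.univ.pi s).indicator (fun v => ∏ i, f i (v i)) v
      = ∏ i, (s i).indicator (f i) (v i) := by
    by_cases hv : v ∈ Set.univ.pi s
    · rw [Set.indicator_of_mem hv]
      exact Finset.prod_congr rfl fun i _ => (Set.indicator_of_mem (hv i trivial) _).symm
    · obtain ⟨i, hi⟩ : ∃ i, v i ∉ s i := by simpa using hv
      rw [Set.indicator_of_notMem hv,
        Finset.prod_eq_zero (Finset.mem_univ i) (Set.indicator_of_notMem hi _)]
  simp_rw [withDensity_apply _ (MeasurableSet.univ_pi hs), withDensity_apply _ (hs _),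
    ← lintegral_indicator (MeasurableSet.univ_pi hs), ← lintegral_indicator (hs _), hind]
  exact lintegral_pi_prod fun i => (hf i).indicator (hs i)

theorem pi_le_ofReal_exp_mul_pi {E : Type*} [MeasurableSpace E] {μ ν : Measure E}
    [IsProbabilityMeasure μ] {f : E → ℝ} (hf : Measurable f)
    (hν : ν ≤ μ.withDensity fun e => ENNReal.ofReal (Real.exp (f e))) {n : ℕ} {c : ℝ}
    {S : Set (Fin n → E)} (hS : MeasurableSet S) (hSc : ∀ v ∈ S, ∑ k, f (v k) ≤ c) :
    Measure.pi (fun _ => ν) S ≤ ENNReal.ofReal (Real.exp c) * Measure.pi (fun _ => μ) S := by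
  have hg : Measurable fun e => ENNReal.ofReal (Real.exp (f e)) := by fun_prop
  calc Measure.pi (fun _ : Fin n => ν) S
      ≤ Measure.pi (fun _ => μ.withDensity fun e => ENNReal.ofReal (Real.exp (f e))) S :=
        pi_mono (fun _ => hν) S
    _ = ∫⁻ v in S, ∏ k, ENNReal.ofReal (Real.exp (f (v k))) ∂Measure.pi fun _ => μ := by
        rw [pi_withDensity fun _ => hg, withDensity_apply _ hS]
    _ ≤ ∫⁻ _ in S, ENNReal.ofReal (Real.exp c) ∂Measure.pi fun _ => μ := by
        refine setLIntegral_mono' hS fun v hv => ?_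
        rw [← ENNReal.ofReal_prod_of_nonneg fun _ _ => (Real.exp_pos _).le, ← Real.exp_sum]
        gcongr
        exact hSc v hv
    _ = ENNReal.ofReal (Real.exp c) * Measure.pi (fun _ => μ) S := setLIntegral_const _ _

variable {Ω E : Type*} [MeasurableSpace Ω] [MeasurableSpace E] {P : Measure Ω}
  {V : ℕ → Ω → E}

theorem map_fin_eq_pi (hV : ∀ k, Measurable (V k)) (hVi : iIndepFun V P)
    (hVd : ∀ k, IdentDistrib (V k) (V 0) P P) (n : ℕ) :
    P.map (fun ω (k : Fin n) => V k ω) = Measure.pi fun _ => P.map (V 0) := by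
  rw [iIndepFun.map_fun_eq_pi_map (fun k => (hV _).aemeasurable)
    (hVi.precomp Fin.val_injective)]
  simp_rw [(hVd _).map_eq]

theorem tendsto_pi_average_near (ν : Measure E) [IsProbabilityMeasure ν] {ι : Type*} [Finite ι]
    {Y : ι → E → ℝ} (hY : ∀ i, Measurable (Y i)) (hYint : ∀ i, Integrable (Y i) ν) {δ : ℝ}
    (hδ : 0 < δ) :
    Tendsto (fun n : ℕ => Measure.pi (fun _ : Fin n => ν)
      {v | ∀ i, |(∑ k, Y i (v k)) / n - ∫ e, Y i e ∂ν| < δ}) atTop (𝓝 1) := by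
  set Q := Measure.infinitePi fun _ : ℕ => ν
  set W : ℕ → (ℕ → E) → E := fun k ω => ω k
  have hW (k : ℕ) : Measurable (W k) := measurable_pi_apply k
  have hWν (k : ℕ) : Q.map (W k) = ν := Measure.infinitePi_map_eval _ k
  have hWi : iIndepFun W Q := iIndepFun_infinitePi (X := fun _ => id) fun _ => measurable_id
  have hWd (k : ℕ) : IdentDistrib (W k) (W 0) Q Q :=
    ⟨(hW k).aemeasurable, (hW 0).aemeasurable, by rw [hWν, hWν]⟩
  have h := tendsto_measure_average_near hW hWi hWd hY (fun i => (hWν 0).symm ▸ hYint i) hδ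
  refine h.congr fun n => ?_
  rw [← hWν 0, ← map_fin_eq_pi hW hWi hWd n, Measure.map_apply (by fun_prop)
    (measurableSet_average_near measurable_pi_apply hY _ n _ δ)]
  simp [Finset.sum_range, hWν 0]

/-- Cramér's change of measure: the empirical mean of the log-density `f` is kept near its own mean
along with those of `Y`, which bounds the density of the product measures. -/
theorem neg_integral_le_expGrowthInf [IsProbabilityMeasure P] {ι : Type*} [Finite ι]
    (hV : ∀ k, Measurable (V k)) (hVi : iIndepFun V P)
    (hVd : ∀ k, IdentDistrib (V k) (V 0) P P) {ν : Measure E} [IsProbabilityMeasure ν]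
    {f : E → ℝ} (hf : Measurable f) (hfint : Integrable f ν)
    (hν : ν ≤ (P.map (V 0)).withDensity fun e => ENNReal.ofReal (Real.exp (f e)))
    {Y : ι → E → ℝ} (hY : ∀ i, Measurable (Y i)) (hYint : ∀ i, Integrable (Y i) ν) {δ : ℝ}
    (hδ : 0 < δ) :
    (-∫ e, f e ∂ν : ℝ) ≤ expGrowthInf fun n : ℕ =>
      P {ω | ∀ i, |(∑ k ∈ Finset.range n, Y i (V k ω)) / n - ∫ e, Y i e ∂ν| < δ} := by
  have : IsProbabilityMeasure (P.map (V 0)) :=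
    Measure.isProbabilityMeasure_map (hV 0).aemeasurable
  refine EReal.ge_of_forall_gt_iff_ge.1 fun r hr => ?_
  have hr' : 0 < -r - ∫ e, f e ∂ν := by linarith [EReal.coe_lt_coe_iff.1 hr]
  rw [← expGrowthInf_exp (a := (r : EReal))]
  refine expGrowthInf_of_eventually_ge (b := 2⁻¹) (by simp) ?_
  let Z : Option ι → E → ℝ := fun o => o.elim f Y
  have hZ : ∀ o, Measurable (Z o) := Option.rec hf hY
  have hnear := (tendsto_pi_average_near ν hZ (Option.rec hfint hYint)
    (lt_min hδ hr')).eventually_const_le (show (2⁻¹ : ℝ≥0∞) < 1 by simp)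
  filter_upwards [hnear, eventually_gt_atTop 0] with n hn hn0
  set S : Set (Fin n → E) :=
    {v | ∀ o, |(∑ k, Z o (v k)) / n - ∫ e, Z o e ∂ν| < min δ (-r - ∫ e, f e ∂ν)}
  have hS : MeasurableSet S := measurableSet_average_near measurable_pi_apply hZ _ n _ _
  have hSf : ∀ v ∈ S, ∑ k, f (v k) ≤ n * (-r) := fun v hv => by
    have hlt := (abs_lt.1 ((hv none).trans_le (min_le_right _ _))).2
    rw [← div_le_iff₀' (by positivity)]
    simp only [Z, Option.elim_none] at hlt
    linarith
  calc 2⁻¹ * EReal.exp (r * n)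
      ≤ Measure.pi (fun _ => ν) S * EReal.exp (r * n) := by gcongr
    _ ≤ ENNReal.ofReal (Real.exp (n * -r)) * Measure.pi (fun _ => P.map (V 0)) S
          * EReal.exp (r * n) := by
        gcongr
        exact pi_le_ofReal_exp_mul_pi hf hν hS hSf
    _ = Measure.pi (fun _ => P.map (V 0)) S := by
        rw [← ofReal_exp_mul_natCast, mul_right_comm, ← ENNReal.ofReal_mul (Real.exp_pos _).le,
          ← Real.exp_add]
        simp
    _ ≤ P {ω | ∀ i, |(∑ k ∈ Finset.range n, Y i (V k ω)) / n - ∫ e, Y i e ∂ν| < δ} := by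
        rw [← map_fin_eq_pi hV hVi hVd, Measure.map_apply (by fun_prop) hS]
        refine measure_mono fun ω hω i => ?_
        rw [Finset.sum_range]
        exact (hω (some i)).trans_le (min_le_left _ _)

end ChangeOfMeasure

/-! ### Sums of extended reals -/

section EReal

variable {ι : Type*} {t : ι → EReal}

theorem sum_ne_bot (ht : ∀ i, t i ≠ ⊥) (s : Finset ι) : ∑ i ∈ s, t i ≠ ⊥ :=
  Finset.sum_induction t (· ≠ ⊥) (fun _ _ ha hb => by simp [EReal.add_eq_bot_iff, ha, hb])
    EReal.zero_ne_bot fun i _ => ht i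

theorem continuousAt_sum_of_ne_bot (ht : ∀ i, t i ≠ ⊥) (s : Finset ι) :
    ContinuousAt (fun r : ι → EReal => ∑ i ∈ s, r i) t := by
  classical
  induction s using Finset.induction_on with
  | empty => simp [continuousAt_const]
  | insert i s hi ih =>
    simp only [Finset.sum_insert hi]
    exact (EReal.continuousAt_add (.inr (sum_ne_bot ht s)) (.inl (ht i))).comp_of_eq
      ((continuous_apply i).continuousAt.prodMk ih) rfl

variable [Fintype ι]

theorem coe_sum (f : ι → ℝ) : ((∑ i, f i : ℝ) : EReal) = ∑ i, (f i : EReal) :=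
  map_sum (⟨⟨Real.toEReal, rfl⟩, EReal.coe_add⟩ : ℝ →+ EReal) f Finset.univ

theorem exists_coe_lt_of_coe_lt_sum (ht : ∀ i, t i ≠ ⊥) {a : ℝ} (h : (a : EReal) < ∑ i, t i) :
    ∃ r : ι → ℝ, (∀ i, (r i : EReal) < t i) ∧ a < ∑ i, r i := by
  have hbelow (i : ι) : (𝓝[<] t i).NeBot := nhdsLT_neBot_of_exists_lt ⟨⊥, (ht i).bot_lt⟩
  have hle : Filter.pi (fun i => 𝓝[<] t i) ≤ 𝓝 t :=
    (Filter.pi_mono fun i => nhdsWithin_le_nhds).trans_eq nhds_pi.symm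
  have hr : ∀ᶠ r : ι → EReal in Filter.pi fun i => 𝓝[<] t i,
      (a : EReal) < ∑ i, r i ∧ ∀ i, r i ∈ Set.Ioo ⊥ (t i) :=
    (((continuousAt_sum_of_ne_bot ht _).eventually (lt_mem_nhds h)).filter_mono hle).and
      (eventually_all.2 fun i => (tendsto_eval_pi _ i).eventually
        (Ioo_mem_nhdsLT (ht i).bot_lt))
  obtain ⟨r, hra, hr⟩ := hr.exists
  lift r to ι → ℝ using fun i => ⟨((hr i).2.trans_le le_top).ne, (hr i).1.ne'⟩
  exact ⟨r, fun i => (hr i).2, by rwa [← coe_sum, EReal.coe_lt_coe_iff] at hra⟩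

theorem exists_lt_coe_of_sum_lt_coe (ht : ∀ i, t i ≠ ⊥) {a : ℝ} (h : ∑ i, t i < (a : EReal)) :
    ∃ r : ι → ℝ, (∀ i, t i < (r i : EReal)) ∧ ∑ i, r i < a := by
  have ht' (i : ι) : t i ≠ ⊤ := by
    classical
    rintro hi
    rw [← Finset.add_sum_erase _ t (Finset.mem_univ i), hi,
      EReal.top_add_of_ne_bot (sum_ne_bot ht _)] at h
    exact not_top_lt h
  have habove (i : ι) : (𝓝[>] t i).NeBot := nhdsGT_neBot_of_exists_gt ⟨⊤, (ht' i).lt_top⟩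
  have hle : Filter.pi (fun i => 𝓝[>] t i) ≤ 𝓝 t :=
    (Filter.pi_mono fun i => nhdsWithin_le_nhds).trans_eq nhds_pi.symm
  have hr : ∀ᶠ r : ι → EReal in Filter.pi fun i => 𝓝[>] t i,
      ∑ i, r i < (a : EReal) ∧ ∀ i, r i ∈ Set.Ioo (t i) ⊤ :=
    (((continuousAt_sum_of_ne_bot ht _).eventually (gt_mem_nhds h)).filter_mono hle).and
      (eventually_all.2 fun i => (tendsto_eval_pi _ i).eventually
        (Ioo_mem_nhdsGT (ht' i).lt_top))
  obtain ⟨r, hra, hr⟩ := hr.exists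
  lift r to ι → ℝ using fun i => ⟨(hr i).2.ne, (bot_le.trans_lt (hr i).1).ne'⟩
  exact ⟨r, fun i => (hr i).1, by rwa [← coe_sum, EReal.coe_lt_coe_iff] at hra⟩

end EReal

/-! ### The dual description of the rate function -/

section Duality

/-- The moment generating function `θ ↦ E[exp (θ X)]` with values in `[0, ∞]`; its logarithm is
`logMGF`. -/
noncomputable def emgf {Ω : Type*} [MeasurableSpace Ω] (P : Measure Ω) (X : Ω → ℝ) (θ : ℝ) :
    ℝ≥0∞ :=
  ∫⁻ ω, ENNReal.ofReal (Real.exp (θ * X ω)) ∂P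

/-- The total mass of the law of `X` after scaling by `p` and tilting by `exp (η + θ X)`. -/
noncomputable def tiltedMass {Ω : Type*} [MeasurableSpace Ω] (P : Measure Ω) (X : Ω → ℝ)
    (p : ℝ≥0∞) (η θ : ℝ) : ℝ≥0∞ :=
  p * ENNReal.ofReal (Real.exp η) * emgf P X θ

/-- The affine functional of `(φ, d)` with dual variables `(η, θ)`; the summand
`rateTerm (fenchelLegendre P X) p φ d` of the rate function is the supremum of those for which
`tiltedMass P X p η θ` is finite. -/
noncomputable def dualTerm {Ω : Type*} [MeasurableSpace Ω] (P : Measure Ω) (X : Ω → ℝ)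
    (p : ℝ≥0∞) (η θ φ d : ℝ) : ℝ :=
  η * φ + θ * d + φ - (tiltedMass P X p η θ).toReal

/-- The affine functional of `(φ, d)` attached to the dual variables `(η, θ)`, for the whole rate
function. -/
noncomputable def dualValue {Ω : Type*} [MeasurableSpace Ω] {N : ℕ} (P : Measure Ω) (X : Ω → ℝ)
    (p : Fin N → ℝ≥0∞) (η θ φ d : Fin N → ℝ) : ℝ :=
  ∑ i, dualTerm P X (p i) (η i) (θ i) (φ i) (d i)

theorem mul_add_lt_coe_iff {φ l r : ℝ} {x : EReal} (hφ : 0 < φ) :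
    (φ : EReal) * (l + x) < r ↔ x < (r / φ - l : ℝ) := by
  induction x with
  | bot => simpa only [EReal.add_bot, EReal.coe_mul_bot_of_pos hφ] using
      iff_of_true (EReal.bot_lt_coe _) (EReal.bot_lt_coe _)
  | top => simp [EReal.coe_mul_top_of_pos hφ]
  | coe x =>
    norm_cast
    rw [lt_sub_iff_add_lt', lt_div_iff₀' hφ]

theorem coe_lt_mul_add_iff {φ l r : ℝ} {x : EReal} (hφ : 0 < φ) :
    (r : EReal) < φ * (l + x) ↔ (r / φ - l : ℝ) < x := by
  induction x with
  | bot => simp [EReal.coe_mul_bot_of_pos hφ]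
  | top => simpa only [EReal.coe_add_top, EReal.coe_mul_top_of_pos hφ] using
      iff_of_true (EReal.coe_lt_top _) (EReal.coe_lt_top _)
  | coe x =>
    norm_cast
    rw [sub_lt_iff_lt_add', div_lt_iff₀' hφ]

theorem log_ofReal_div_eq_coe {p : ℝ≥0∞} (hp : p ≠ ⊤) (hp0 : p ≠ 0) {φ : ℝ} (hφ : 0 < φ) :
    ENNReal.log (ENNReal.ofReal φ / p) = (Real.log (φ / p.toReal) : ℝ) := by
  rw [← ENNReal.ofReal_toReal hp, ← ENNReal.ofReal_div_of_pos (ENNReal.toReal_pos hp0 hp),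
    ENNReal.toReal_ofReal ENNReal.toReal_nonneg, ENNReal.log_ofReal_of_pos]
  exact div_pos hφ (ENNReal.toReal_pos hp0 hp)

variable {Ω : Type*} [MeasurableSpace Ω] {P : Measure Ω} {X : Ω → ℝ} {N : ℕ}

theorem logMGF_eq_log_emgf (θ : ℝ) : logMGF P X θ = ENNReal.log (emgf P X θ) := rfl

theorem continuous_increment (i : Fin N) : Continuous fun x : PathSpace N => increment x.1 i := by
  have h (j : Fin N) : Continuous fun x : PathSpace N => x.1 j :=
    (continuous_apply j).comp continuous_subtype_val
  unfold increment
  split_ifs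
  · exact (h i).sub continuous_const
  · exact (h i).sub (h _)

theorem continuous_dualValue_increment (p : Fin N → ℝ≥0∞) (η θ : Fin N → ℝ) :
    Continuous fun z : PathSpace N × (Fin N → ℝ) =>
      dualValue P X p η θ z.2 (fun i => increment z.1.1 i) := by
  have h (i : Fin N) : Continuous fun z : PathSpace N × (Fin N → ℝ) => increment z.1.1 i :=
    (continuous_increment i).comp continuous_fst
  unfold dualValue dualTerm
  fun_prop

theorem tiltedMass_ne_top {p : ℝ≥0∞} (hp : p ≠ ⊤) {η θ : ℝ} (hM : emgf P X θ ≠ ⊤) :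
    tiltedMass P X p η θ ≠ ⊤ :=
  ENNReal.mul_ne_top (ENNReal.mul_ne_top hp ENNReal.ofReal_ne_top) hM

theorem toReal_tiltedMass (p : ℝ≥0∞) (η θ : ℝ) :
    (tiltedMass P X p η θ).toReal = p.toReal * Real.exp η * (emgf P X θ).toReal := by
  rw [tiltedMass, ENNReal.toReal_mul, ENNReal.toReal_mul,
    ENNReal.toReal_ofReal (Real.exp_pos _).le]

/-- Letting `η → -∞` removes the mass, and only the affine part remains. -/
theorem exists_lt_dualTerm_zero {p : ℝ≥0∞} {d θ a : ℝ} (h : a < θ * d) :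
    ∃ η, a < dualTerm P X p η θ 0 d := by
  have hlim : Tendsto (fun η => dualTerm P X p η θ 0 d) atBot
      (𝓝 (θ * d - p.toReal * 0 * (emgf P X θ).toReal)) := by
    simp only [dualTerm, toReal_tiltedMass, mul_zero, zero_add, add_zero]
    simpa using ((Real.tendsto_exp_atBot.const_mul _).mul_const _).const_sub _
  exact (hlim.eventually (lt_mem_nhds (by simpa using h))).exists

variable [IsProbabilityMeasure P]

theorem emgf_zero : emgf P X 0 = 1 := by simp [emgf]

theorem emgf_ne_zero (hX : Measurable X) (θ : ℝ) : emgf P X θ ≠ 0 := by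
  intro h
  rw [emgf, lintegral_eq_zero_iff (by fun_prop)] at h
  obtain ⟨ω, hω⟩ := h.exists
  simp [not_le.2 (Real.exp_pos _)] at hω

theorem logMGF_eq_coe (hX : Measurable X) {θ : ℝ} (h : emgf P X θ ≠ ⊤) :
    logMGF P X θ = (Real.log (emgf P X θ).toReal : ℝ) := by
  rw [logMGF_eq_log_emgf, ENNReal.log_pos_real (emgf_ne_zero hX θ) h]

theorem tiltedMass_zero_zero (p : ℝ≥0∞) : tiltedMass P X p 0 0 = p := by
  simp [tiltedMass, emgf_zero]

theorem fenchelLegendre_nonneg (x : ℝ) : 0 ≤ fenchelLegendre P X x :=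
  le_iSup_of_le 0 (by simp [logMGF_eq_log_emgf, emgf_zero])

theorem le_fenchelLegendre (hX : Measurable X) {θ : ℝ} (hM : emgf P X θ ≠ ⊤) (x : ℝ) :
    ((θ * x - Real.log (emgf P X θ).toReal : ℝ) : EReal) ≤ fenchelLegendre P X x := by
  rw [EReal.coe_sub, ← logMGF_eq_coe hX hM]
  exact le_iSup (fun θ : ℝ => ((θ * x : ℝ) : EReal) - logMGF P X θ) θ

theorem exists_lt_of_coe_lt_fenchelLegendre (hX : Measurable X) {x a : ℝ}
    (h : (a : EReal) < fenchelLegendre P X x) :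
    ∃ θ, emgf P X θ ≠ ⊤ ∧ a < θ * x - Real.log (emgf P X θ).toReal := by
  obtain ⟨θ, hθ⟩ := lt_iSup_iff.1 h
  have hM : emgf P X θ ≠ ⊤ := by
    intro htop
    rw [logMGF_eq_log_emgf, htop, ENNReal.log_top, EReal.sub_top] at hθ
    exact not_lt_bot hθ
  rw [logMGF_eq_coe hX hM] at hθ
  exact ⟨θ, hM, by exact_mod_cast hθ⟩

theorem rateTerm_zero_left {φ d : ℝ} (hφ : 0 < φ) :
    rateTerm (fenchelLegendre P X) 0 φ d = ⊤ := by
  have h : ENNReal.ofReal φ / 0 = ⊤ := ENNReal.div_zero (by simpa using hφ)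
  rw [rateTerm, if_neg hφ.ne', h, ENNReal.log_top, EReal.top_add_of_ne_bot,
    EReal.coe_mul_top_of_pos hφ]
  exact ne_bot_of_le_ne_bot EReal.zero_ne_bot (fenchelLegendre_nonneg _)

theorem rateTerm_of_pos (Λstar : ℝ → EReal) {p : ℝ≥0∞} (hp : p ≠ ⊤) (hp0 : p ≠ 0) {φ : ℝ}
    (hφ : 0 < φ) (d : ℝ) :
    rateTerm Λstar p φ d = φ * ((Real.log (φ / p.toReal) : ℝ) + Λstar (d / φ)) := by
  rw [rateTerm, if_neg hφ.ne', log_ofReal_div_eq_coe hp hp0 hφ]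

theorem dualTerm_le_mul_log_add (hX : Measurable X) {p : ℝ≥0∞} (hp : p ≠ ⊤) (hp0 : p ≠ 0)
    {φ : ℝ} (hφ : 0 < φ) {θ : ℝ} (hM : emgf P X θ ≠ ⊤) (d η : ℝ) :
    dualTerm P X p η θ φ d ≤ φ * (Real.log (φ / p.toReal)
      + (θ * (d / φ) - Real.log (emgf P X θ).toReal)) := by
  have hr : 0 < p.toReal := ENNReal.toReal_pos hp0 hp
  have hm : 0 < (emgf P X θ).toReal := ENNReal.toReal_pos (emgf_ne_zero hX θ) hM
  rw [dualTerm, toReal_tiltedMass]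
  set r := p.toReal
  set m := (emgf P X θ).toReal
  have hlog : η + Real.log m - Real.log (φ / r) ≤ r * Real.exp η * m / φ - 1 := by
    have h := Real.log_le_sub_one_of_pos (show 0 < r * Real.exp η * m / φ by positivity)
    rw [Real.log_div (by positivity) hφ.ne', Real.log_mul (by positivity) hm.ne',
      Real.log_mul hr.ne' (Real.exp_pos _).ne', Real.log_exp] at h
    rw [Real.log_div hφ.ne' hr.ne']
    linarith
  have hmul := mul_le_mul_of_nonneg_left hlog hφ.le
  rw [mul_sub _ _ (1 : ℝ), mul_div_cancel₀ _ hφ.ne'] at hmul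
  have hd : φ * (θ * (d / φ)) = θ * d := by field_simp
  linarith

theorem dualTerm_le_rateTerm (hX : Measurable X) {p : ℝ≥0∞} (hp : p ≠ ⊤) {φ d η θ : ℝ}
    (hφ : 0 ≤ φ) (hq : tiltedMass P X p η θ ≠ ⊤) :
    (dualTerm P X p η θ φ d : EReal) ≤ rateTerm (fenchelLegendre P X) p φ d := by
  rcases hφ.eq_or_lt with rfl | hφ
  · rw [rateTerm, if_pos rfl]
    split_ifs with hd
    · have := ENNReal.toReal_nonneg (a := tiltedMass P X p η θ)
      rw [← EReal.coe_zero, EReal.coe_le_coe_iff, dualTerm, hd]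
      linarith
    · exact le_top
  rcases eq_or_ne p 0 with rfl | hp0
  · exact le_top.trans_eq (rateTerm_zero_left (P := P) hφ).symm
  have hM : emgf P X θ ≠ ⊤ := by
    intro h
    refine hq ?_
    rw [tiltedMass, h, ENNReal.mul_top]
    simp [hp0, Real.exp_pos]
  by_contra! hlt
  rw [rateTerm_of_pos _ hp hp0 hφ, mul_add_lt_coe_iff hφ] at hlt
  have h := EReal.coe_lt_coe_iff.1 ((le_fenchelLegendre hX hM (d / φ)).trans_lt hlt)
  rw [lt_sub_iff_add_lt', lt_div_iff₀' hφ] at h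
  exact (dualTerm_le_mul_log_add hX hp hp0 hφ hM d η).not_gt h

theorem exists_lt_dualTerm_of_pos (hX : Measurable X) {p : ℝ≥0∞} (hp : p ≠ ⊤) (hp0 : p ≠ 0)
    {φ d r : ℝ} (hφ : 0 < φ) (h : (r : EReal) < rateTerm (fenchelLegendre P X) p φ d) :
    ∃ η θ : ℝ, tiltedMass P X p η θ ≠ ⊤ ∧ r < dualTerm P X p η θ φ d := by
  rw [rateTerm_of_pos _ hp hp0 hφ, coe_lt_mul_add_iff hφ] at h
  obtain ⟨θ, hM, hθ⟩ := exists_lt_of_coe_lt_fenchelLegendre hX h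
  have hr : 0 < p.toReal := ENNReal.toReal_pos hp0 hp
  have hm : 0 < (emgf P X θ).toReal := ENNReal.toReal_pos (emgf_ne_zero hX θ) hM
  -- this `η` tilts the mass to `φ`, the equality case of `log x ≤ x - 1`
  refine ⟨Real.log (φ / p.toReal) - Real.log (emgf P X θ).toReal, θ, tiltedMass_ne_top hp hM, ?_⟩
  rw [dualTerm, toReal_tiltedMass, Real.exp_sub, Real.exp_log hm, Real.exp_log (by positivity)]
  have hmass : p.toReal * (φ / p.toReal / (emgf P X θ).toReal) * (emgf P X θ).toReal = φ := by
    field_simp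
  rw [sub_lt_iff_lt_add', div_lt_iff₀' hφ] at hθ
  have hd : φ * (θ * (d / φ)) = θ * d := by field_simp
  linarith

theorem exists_lt_dualTerm (hX : Measurable X) {p : ℝ≥0∞} (hp : p ≠ ⊤) {φ d r : ℝ}
    (hφ : 0 ≤ φ) (hM : 0 < φ ∨ ∀ θ, emgf P X θ ≠ ⊤)
    (h : (r : EReal) < rateTerm (fenchelLegendre P X) p φ d) :
    ∃ η θ : ℝ, tiltedMass P X p η θ ≠ ⊤ ∧ r < dualTerm P X p η θ φ d := by
  rcases hφ.eq_or_lt with rfl | hφ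
  · obtain ⟨θ, hθ⟩ : ∃ θ, r < θ * d := by
      rw [rateTerm, if_pos rfl] at h
      split_ifs at h with hd
      · exact ⟨0, by simpa using h⟩
      · exact ⟨(r + 1) / d, by rw [div_mul_cancel₀ _ hd]; linarith⟩
    obtain ⟨η, hη⟩ := exists_lt_dualTerm_zero (P := P) (X := X) (p := p) hθ
    exact ⟨η, θ, tiltedMass_ne_top hp (hM.resolve_left (lt_irrefl _) θ), hη⟩
  rcases eq_or_ne p 0 with rfl | hp0
  · exact ⟨r / φ, 0, by simp [tiltedMass], by simp [dualTerm, tiltedMass, hφ, hφ.ne']⟩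
  · exact exists_lt_dualTerm_of_pos hX hp hp0 hφ h

theorem rateTerm_ne_bot (hX : Measurable X) {p : ℝ≥0∞} (hp : p ≠ ⊤) {φ : ℝ} (hφ : 0 ≤ φ)
    (d : ℝ) : rateTerm (fenchelLegendre P X) p φ d ≠ ⊥ :=
  ne_bot_of_le_ne_bot (EReal.coe_ne_bot _) <|
    dualTerm_le_rateTerm (P := P) (η := 0) (θ := 0) hX hp hφ (by rwa [tiltedMass_zero_zero])

theorem dualValue_le_sum_rateTerm (hX : Measurable X) {p : Fin N → ℝ≥0∞} (hp : ∀ i, p i ≠ ⊤)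
    {η θ φ d : Fin N → ℝ} (hφ : ∀ i, 0 ≤ φ i) (hq : ∀ i, tiltedMass P X (p i) (η i) (θ i) ≠ ⊤) :
    (dualValue P X p η θ φ d : EReal)
      ≤ ∑ i, rateTerm (fenchelLegendre P X) (p i) (φ i) (d i) := by
  rw [dualValue, coe_sum]
  exact Finset.sum_le_sum fun i _ => dualTerm_le_rateTerm hX (hp i) (hφ i) (hq i)

theorem exists_lt_dualValue (hX : Measurable X) {p : Fin N → ℝ≥0∞} (hp : ∀ i, p i ≠ ⊤)
    {φ d : Fin N → ℝ} (hφ : ∀ i, 0 ≤ φ i) (hM : ∀ i, 0 < φ i ∨ ∀ θ, emgf P X θ ≠ ⊤) {a : ℝ}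
    (h : (a : EReal) < ∑ i, rateTerm (fenchelLegendre P X) (p i) (φ i) (d i)) :
    ∃ η θ : Fin N → ℝ, (∀ i, tiltedMass P X (p i) (η i) (θ i) ≠ ⊤) ∧
      a < dualValue P X p η θ φ d := by
  obtain ⟨r, hr, ha⟩ :=
    exists_coe_lt_of_coe_lt_sum (fun i => rateTerm_ne_bot hX (hp i) (hφ i) (d i)) h
  choose η θ hq hlt using fun i => exists_lt_dualTerm hX (hp i) (hφ i) (hM i) (hr i)
  exact ⟨η, θ, hq, ha.trans_le (Finset.sum_le_sum fun i _ => (hlt i).le)⟩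

theorem pos_of_mem_stdSimplex_of_le_one (hN : N ≤ 1) {φ : Fin N → ℝ}
    (hφ : φ ∈ stdSimplex ℝ (Fin N)) (i : Fin N) : 0 < φ i := by
  have := Fin.subsingleton_iff_le_one.2 hN
  have hsum := hφ.2
  rw [Fintype.sum_subsingleton φ i] at hsum
  exact hsum ▸ one_pos

theorem rateFunction_nonneg (hX : Measurable X) {p : Fin N → ℝ≥0∞} (hp : ∑ i, p i = 1)
    (x : PathSpace N) : 0 ≤ rateFunction P X p x := by
  have hp' (i : Fin N) : p i ≠ ⊤ := (ENNReal.sum_ne_top.1 (by simp [hp])) i (Finset.mem_univ i)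
  refine le_iInf₂ fun φ hφ => ?_
  have hzero : dualValue P X p 0 0 φ (increment x.1) = 0 := by
    simp [dualValue, dualTerm, tiltedMass_zero_zero, Finset.sum_sub_distrib, hφ.2,
      ← ENNReal.toReal_sum fun i _ => hp' i, hp]
  have hle := dualValue_le_sum_rateTerm (P := P) (η := 0) (θ := 0) (d := increment x.1) hX hp' hφ.1
    fun i => by simpa [tiltedMass_zero_zero] using hp' i
  rwa [hzero, EReal.coe_zero] at hle

theorem lowerSemicontinuous_rateFunction (hX : Measurable X) {p : Fin N → ℝ≥0∞}
    (hp : ∀ i, p i ≠ ⊤) (hM : N ≤ 1 ∨ ∀ θ, emgf P X θ ≠ ⊤) :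
    LowerSemicontinuous (rateFunction P X p) := by
  intro x a hax
  obtain ⟨b, hab, hbx⟩ := exists_between hax
  obtain ⟨c, hbc, hcx⟩ := EReal.exists_between_coe_real hbx
  have hnear : ∀ᶠ y in 𝓝 x, ∀ φ ∈ stdSimplex ℝ (Fin N), φ ∈ stdSimplex ℝ (Fin N) →
      (c : EReal) < ∑ i, rateTerm (fenchelLegendre P X) (p i) (φ i) (increment y.1 i) := by
    refine (isCompact_stdSimplex ℝ (Fin N)).eventually_forall_of_forall_eventually
      fun φ hφ => ?_
    obtain ⟨η, θ, hq, hlt⟩ := exists_lt_dualValue hX hp hφ.1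
      (fun i => hM.imp_left fun hN => pos_of_mem_stdSimplex_of_le_one hN hφ i)
      (hcx.trans_le (iInf₂_le φ hφ))
    filter_upwards [(continuous_dualValue_increment p η θ).tendsto (x, φ) |>.eventually
      (lt_mem_nhds hlt)] with z hz hzΦ
    exact (EReal.coe_lt_coe_iff.2 hz).trans_le (dualValue_le_sum_rateTerm hX hp hzΦ.1 hq)
  filter_upwards [hnear] with y hy
  exact hab.trans (hbc.trans_le (le_iInf₂ fun φ hφ => (hy φ hφ hφ).le))

end Duality

/-! ### Exponential tilting to a prescribed mean -/

section Tilting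

variable {Ω : Type*} [MeasurableSpace Ω]

theorem tendsto_mgf_atTop {ν : Measure Ω} [IsFiniteMeasure ν] {X : Ω → ℝ}
    (hint : ∀ t, Integrable (fun ω => Real.exp (t * X ω)) ν) (hpos : ν {ω | 0 < X ω} ≠ 0) :
    Tendsto (mgf X ν) atTop atTop := by
  obtain ⟨k, hk⟩ : ∃ k : ℕ, ν {ω | 1 / ((k : ℝ) + 1) ≤ X ω} ≠ 0 := by
    by_contra! hnull
    refine hpos (measure_mono_null (fun ω hω => ?_) (measure_iUnion_null hnull))
    obtain ⟨k, hk⟩ := exists_nat_one_div_lt (K := ℝ) hω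
    exact Set.mem_iUnion.2 ⟨k, hk.le⟩
  set ε : ℝ := 1 / ((k : ℝ) + 1)
  have hε : 0 < ε := Nat.one_div_pos_of_nat
  have hm : 0 < ν.real {ω | ε ≤ X ω} := ENNReal.toReal_pos hk (measure_ne_top _ _)
  have hlim : Tendsto (fun t : ℝ => Real.exp (t * ε) * ν.real {ω | ε ≤ X ω}) atTop atTop :=
    (Real.tendsto_exp_atTop.comp (tendsto_id.atTop_mul_const hε)).atTop_mul_const hm
  refine tendsto_atTop_mono' _ ?_ hlim
  filter_upwards [eventually_ge_atTop 0] with t ht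
  have hle := measure_ge_le_exp_mul_mgf ε ht (hint t)
  rwa [neg_mul, Real.exp_neg, ← div_eq_inv_mul, le_div_iff₀' (Real.exp_pos _)] at hle

theorem tendsto_mgf_cocompact {ν : Measure Ω} [IsFiniteMeasure ν] {X : Ω → ℝ}
    (hint : ∀ t, Integrable (fun ω => Real.exp (t * X ω)) ν) (hpos : ν {ω | 0 < X ω} ≠ 0)
    (hneg : ν {ω | X ω < 0} ≠ 0) : Tendsto (mgf X ν) (cocompact ℝ) atTop := by
  rw [cocompact_eq_atBot_atTop]
  refine Tendsto.sup ?_ (tendsto_mgf_atTop hint hpos)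
  have h := (tendsto_mgf_atTop (X := -X) (ν := ν) (fun t => by simpa using hint (-t))
    (by simpa using hneg)).comp tendsto_neg_atBot_atTop
  exact h.congr fun t => by simp [mgf_neg]

theorem exists_tilted_integral_eq_zero {ν : Measure Ω} [IsFiniteMeasure ν] {X : Ω → ℝ}
    (hint : ∀ t, Integrable (fun ω => Real.exp (t * X ω)) ν) (hpos : ν {ω | 0 < X ω} ≠ 0)
    (hneg : ν {ω | X ω < 0} ≠ 0) : ∃ θ : ℝ, ∫ ω, X ω ∂ν.tilted (fun ω => θ * X ω) = 0 := by
  obtain ⟨θ, hθ⟩ := (continuous_mgf hint).exists_forall_le (tendsto_mgf_cocompact hint hpos hneg)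
  have hν : ν ≠ 0 := by rintro rfl; simp at hpos
  have huniv : integrableExpSet X ν = Set.univ := Set.eq_univ_of_forall hint
  refine ⟨θ, ?_⟩
  rw [integral_tilted_mul_self (by simp [huniv])]
  exact IsLocalMin.deriv_eq_zero <| Eventually.of_forall fun t =>
    Real.log_le_log (mgf_pos' hν (hint θ)) (hθ t)

variable {P : Measure Ω} {X : Ω → ℝ}

theorem tendsto_measure_inter_abs_le (P : Measure Ω) (X : Ω → ℝ) (S : Set Ω) :
    Tendsto (fun k : ℕ => P (S ∩ {ω | |X ω| ≤ k})) atTop (𝓝 (P S)) := by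
  have hunion : ⋃ k : ℕ, S ∩ {ω | |X ω| ≤ k} = S := by
    rw [← Set.inter_iUnion, Set.inter_eq_left]
    exact fun ω _ => Set.mem_iUnion.2 (exists_nat_ge |X ω|)
  have h := tendsto_measure_iUnion_atTop (μ := P) (s := fun k : ℕ => S ∩ {ω | |X ω| ≤ k})
    fun k l hkl => Set.inter_subset_inter_right _ fun ω (hω : |X ω| ≤ k) =>
      hω.trans (Nat.cast_le.2 hkl)
  rwa [hunion] at h

theorem measurableSet_abs_le (hX : Measurable X) (k : ℕ) : MeasurableSet {ω | |X ω| ≤ k} :=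
  measurableSet_le (by fun_prop) measurable_const

theorem tendsto_emgf_restrict (hX : Measurable X) (θ : ℝ) :
    Tendsto (fun k : ℕ => emgf (P.restrict {ω | |X ω| ≤ k}) X θ) atTop (𝓝 (emgf P X θ)) := by
  have h := tendsto_measure_inter_abs_le
    (P.withDensity fun ω => ENNReal.ofReal (Real.exp (θ * X ω))) X .univ
  simp only [Set.univ_inter, withDensity_apply _ (measurableSet_abs_le hX _),
    withDensity_apply _ MeasurableSet.univ, Measure.restrict_univ] at h
  exact h

theorem integrable_exp_mul_restrict [IsFiniteMeasure P] (hX : Measurable X) (k : ℕ) (θ : ℝ) :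
    Integrable (fun ω => Real.exp (θ * X ω)) (P.restrict {ω | |X ω| ≤ k}) :=
  integrable_exp_mul_of_mem_Icc hX.aemeasurable <|
    (ae_restrict_mem (measurableSet_abs_le hX k)).mono fun _ h => abs_le.1 h

theorem emgf_eq_ofReal_mgf {ν : Measure Ω} {θ : ℝ}
    (hint : Integrable (fun ω => Real.exp (θ * X ω)) ν) :
    emgf ν X θ = ENNReal.ofReal (mgf X ν θ) :=
  (ofReal_integral_eq_lintegral_ofReal hint (ae_of_all _ fun _ => (Real.exp_pos _).le)).symm

theorem eventually_measure_restrict_ne_zero (hX : Measurable X) {S : Set Ω} (hS : P S ≠ 0) :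
    ∀ᶠ k : ℕ in atTop, P.restrict {ω | |X ω| ≤ k} S ≠ 0 :=
  ((tendsto_measure_inter_abs_le P X S).eventually_ne hS).mono fun k hk => by
    rwa [Measure.restrict_apply' (measurableSet_abs_le hX k)]

theorem isCompact_mgf_le {ν : Measure Ω} [IsFiniteMeasure ν]
    (hint : ∀ t, Integrable (fun ω => Real.exp (t * X ω)) ν) (hpos : ν {ω | 0 < X ω} ≠ 0)
    (hneg : ν {ω | X ω < 0} ≠ 0) (c : ℝ) : IsCompact {θ | mgf X ν θ ≤ c} := by
  obtain ⟨K, hK, hKc⟩ := mem_cocompact.1 <|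
    (tendsto_mgf_cocompact hint hpos hneg).eventually_gt_atTop c
  refine hK.of_isClosed_subset (isClosed_le (continuous_mgf hint) continuous_const) fun θ hθ => ?_
  by_contra hθK
  have hlt : c < mgf X ν θ := hKc hθK
  exact hlt.not_ge hθ

/-- The sublevel sets of the truncated generating functions are compact and decrease to the empty
set, so that one of them is empty. -/
theorem exists_forall_lt_mgf_restrict [IsFiniteMeasure P] (hX : Measurable X)
    (hpos : P {ω | 0 < X ω} ≠ 0) (hneg : P {ω | X ω < 0} ≠ 0) {c : ℝ}
    (h : ∀ θ, ENNReal.ofReal c < emgf P X θ) :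
    ∃ k : ℕ, P.restrict {ω | |X ω| ≤ k} {ω | 0 < X ω} ≠ 0 ∧
      P.restrict {ω | |X ω| ≤ k} {ω | X ω < 0} ≠ 0 ∧
      ∀ θ, c < mgf X (P.restrict {ω | |X ω| ≤ k}) θ := by
  set ν : ℕ → Measure Ω := fun k => P.restrict {ω | |X ω| ≤ k}
  have hint (k : ℕ) (θ : ℝ) : Integrable (fun ω => Real.exp (θ * X ω)) (ν k) :=
    integrable_exp_mul_restrict hX k θ
  obtain ⟨k₀, hk₀⟩ := eventually_atTop.1 <|
    (eventually_measure_restrict_ne_zero hX hpos).and (eventually_measure_restrict_ne_zero hX hneg)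
  have hcompact := isCompact_mgf_le (hint k₀) (hk₀ k₀ le_rfl).1 (hk₀ k₀ le_rfl).2 c
  have hclosed (k : ℕ) : IsClosed {θ | mgf X (ν k) θ ≤ c} :=
    isClosed_le (continuous_mgf (hint k)) continuous_const
  have hanti : Antitone fun k => {θ | mgf X (ν k) θ ≤ c} := fun k l hkl θ hθ =>
    (integral_mono_measure (Measure.restrict_mono_set P fun ω (hω : |X ω| ≤ k) =>
      hω.trans (Nat.cast_le.2 hkl)) (ae_of_all _ fun _ => (Real.exp_pos _).le) (hint l θ)).trans hθ
  have hempty : {θ | mgf X (ν k₀) θ ≤ c} ∩ ⋂ k, {θ | mgf X (ν k) θ ≤ c} = ∅ := by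
    refine Set.eq_empty_of_forall_notMem fun θ hθ => ?_
    obtain ⟨k, hk⟩ := ((tendsto_emgf_restrict hX θ).eventually (lt_mem_nhds (h θ))).exists
    rw [emgf_eq_ofReal_mgf (hint k θ)] at hk
    exact (ENNReal.ofReal_lt_ofReal_iff'.1 hk).1.not_ge (Set.mem_iInter.1 hθ.2 k)
  obtain ⟨k, hk⟩ := hcompact.elim_directed_family_closed _ hclosed hempty hanti.directed_ge
  refine ⟨max k₀ k, (hk₀ _ (le_max_left _ _)).1, (hk₀ _ (le_max_left _ _)).2, fun θ => ?_⟩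
  by_contra! hθ
  exact (hk.subset ⟨hanti (le_max_left _ _) hθ, hanti (le_max_right _ _) hθ⟩).elim

theorem le_measure_eq_zero_of_forall_le_emgf [IsFiniteMeasure P] (hX : Measurable X)
    (hX0 : ∀ᵐ ω ∂P, 0 ≤ X ω) {c : ℝ≥0∞} (h : ∀ θ, c ≤ emgf P X θ) : c ≤ P {ω | X ω = 0} := by
  have hS : MeasurableSet {ω | X ω = 0} := hX (measurableSet_singleton 0)
  have hlim : Tendsto (emgf P X) atBot (𝓝 (∫⁻ ω, {ω | X ω = 0}.indicator 1 ω ∂P)) := by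
    refine tendsto_lintegral_filter_of_dominated_convergence (fun _ => 1)
      (.of_forall fun θ => by fun_prop) ?_ (by simp) ?_
    · filter_upwards [eventually_le_atBot 0] with θ hθ
      filter_upwards [hX0] with ω hω
      rw [ENNReal.ofReal_le_one, Real.exp_le_one_iff]
      exact mul_nonpos_of_nonpos_of_nonneg hθ hω
    · filter_upwards [hX0] with ω hω
      rcases hω.eq_or_lt with h' | h'
      · simp [← h']
      · rw [Set.indicator_of_notMem (by simpa using h'.ne'), ← ENNReal.ofReal_zero]
        exact ENNReal.tendsto_ofReal
          (Real.tendsto_exp_atBot.comp (tendsto_id.atBot_mul_const h'))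
  rw [lintegral_indicator_one hS] at hlim
  exact ge_of_tendsto' hlim h

theorem exists_centered_tilt_of_measure_eq_zero [IsFiniteMeasure P] (hX : Measurable X) {L : ℝ}
    (h : ENNReal.ofReal (Real.exp (-L)) ≤ P {ω | X ω = 0}) :
    ∃ (ν : Measure Ω) (θ : ℝ), IsProbabilityMeasure ν ∧ Integrable X ν ∧ ∫ ω, X ω ∂ν = 0 ∧
      ν ≤ P.withDensity fun ω => ENNReal.ofReal (Real.exp (L + θ * X ω)) := by
  have hS : MeasurableSet {ω | X ω = 0} := hX (measurableSet_singleton 0)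
  have hP : P {ω | X ω = 0} ≠ 0 := fun h0 => by simp [h0, not_le.2 (Real.exp_pos _)] at h
  have hX0 : X =ᵐ[P[|{ω | X ω = 0}]] 0 := ae_cond_mem hS
  refine ⟨P[|{ω | X ω = 0}], 0, cond_isProbabilityMeasure hP,
    (integrable_zero _ _ _).congr hX0.symm, integral_eq_zero_of_ae hX0, ?_⟩
  simp only [zero_mul, add_zero, withDensity_const, ProbabilityTheory.cond]
  have hinv : (P {ω | X ω = 0})⁻¹ ≤ ENNReal.ofReal (Real.exp L) := by
    rw [ENNReal.inv_le_iff_inv_le, ← ENNReal.ofReal_inv_of_pos (Real.exp_pos _), ← Real.exp_neg]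
    exact h
  gcongr
  exact Measure.restrict_le_self

/-- The gap between `L'` and `L` leaves room to truncate `X`, which makes all its exponential
moments finite; the tilt is then the minimizer of the generating function. -/
theorem exists_centered_tilt [IsFiniteMeasure P] (hX : Measurable X) {L L' : ℝ} (hL : L' < L)
    (h : ∀ θ, ENNReal.ofReal (Real.exp (-L')) ≤ emgf P X θ) :
    ∃ (ν : Measure Ω) (θ : ℝ), IsProbabilityMeasure ν ∧ Integrable X ν ∧ ∫ ω, X ω ∂ν = 0 ∧
      ν ≤ P.withDensity fun ω => ENNReal.ofReal (Real.exp (L + θ * X ω)) := by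
  have hlt : ENNReal.ofReal (Real.exp (-L)) < ENNReal.ofReal (Real.exp (-L')) := by
    rw [ENNReal.ofReal_lt_ofReal_iff (Real.exp_pos _), Real.exp_lt_exp]
    linarith
  by_cases hneg : P {ω | X ω < 0} = 0
  · refine exists_centered_tilt_of_measure_eq_zero hX (hlt.le.trans ?_)
    exact le_measure_eq_zero_of_forall_le_emgf hX (by simpa [ae_iff] using hneg) h
  by_cases hpos : P {ω | 0 < X ω} = 0
  · refine exists_centered_tilt_of_measure_eq_zero hX (hlt.le.trans ?_)
    have hle := le_measure_eq_zero_of_forall_le_emgf (c := ENNReal.ofReal (Real.exp (-L')))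
      hX.neg (P := P) (by simpa [ae_iff] using hpos) fun θ => by simpa [emgf] using h (-θ)
    simpa using hle
  obtain ⟨k, hkpos, hkneg, hk⟩ :=
    exists_forall_lt_mgf_restrict hX hpos hneg fun θ => hlt.trans_le (h θ)
  set ρ := P.restrict {ω | |X ω| ≤ k}
  have hint := integrable_exp_mul_restrict (P := P) hX k
  obtain ⟨θ, hθ⟩ := exists_tilted_integral_eq_zero hint hkpos hkneg
  have : NeZero ρ := ⟨fun h0 => hkpos (by simp [h0])⟩
  have hprob : IsProbabilityMeasure (ρ.tilted fun ω => θ * X ω) :=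
    isProbabilityMeasure_tilted (hint θ)
  have hbdd : ∀ᵐ ω ∂ρ.tilted fun ω => θ * X ω, ‖X ω‖ ≤ k :=
    (tilted_absolutelyContinuous _ _).ae_le (ae_restrict_mem (measurableSet_abs_le hX k))
  refine ⟨ρ.tilted fun ω => θ * X ω, θ, hprob, .of_bound hX.aestronglyMeasurable k hbdd, hθ, ?_⟩
  calc ρ.tilted (fun ω => θ * X ω)
      ≤ ρ.withDensity fun ω => ENNReal.ofReal (Real.exp (L + θ * X ω)) := by
        refine withDensity_mono (ae_of_all _ fun ω => ENNReal.ofReal_le_ofReal ?_)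
        rw [add_comm, Real.exp_add, ← neg_neg L, Real.exp_neg (-L), ← div_eq_mul_inv]
        exact div_le_div_of_nonneg_left (Real.exp_pos _).le (Real.exp_pos _) (hk θ).le
    _ ≤ P.withDensity fun ω => ENNReal.ofReal (Real.exp (L + θ * X ω)) := by
        rw [← restrict_withDensity (measurableSet_abs_le hX k)]
        exact Measure.restrict_le_self

theorem emgf_sub_const (hX : Measurable X) (x θ : ℝ) :
    emgf P (fun ω => X ω - x) θ = emgf P X θ * ENNReal.ofReal (Real.exp (-(θ * x))) := by
  rw [emgf, emgf, ← lintegral_mul_const _ (by fun_prop)]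
  simp_rw [← ENNReal.ofReal_mul (Real.exp_pos _).le, ← Real.exp_add, mul_sub, sub_eq_add_neg]

theorem ofReal_exp_neg_le_emgf_sub [IsProbabilityMeasure P] (hX : Measurable X) {x L : ℝ}
    (h : fenchelLegendre P X x ≤ L) (θ : ℝ) :
    ENNReal.ofReal (Real.exp (-L)) ≤ emgf P (fun ω => X ω - x) θ := by
  rw [emgf_sub_const hX]
  by_cases hM : emgf P X θ = ⊤
  · simp [hM, Real.exp_pos]
  have hm : 0 < (emgf P X θ).toReal := ENNReal.toReal_pos (emgf_ne_zero hX θ) hM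
  rw [← ENNReal.ofReal_toReal hM, ← ENNReal.ofReal_mul hm.le]
  refine ENNReal.ofReal_le_ofReal ?_
  conv_rhs => rw [← Real.exp_log hm, ← Real.exp_add]
  have hle := EReal.coe_le_coe_iff.1 ((le_fenchelLegendre hX hM x).trans h)
  exact Real.exp_le_exp.2 (by linarith)

theorem exists_tilt [IsProbabilityMeasure P] (hX : Measurable X) {x L : ℝ}
    (h : fenchelLegendre P X x < L) :
    ∃ (ν : Measure Ω) (θ : ℝ), IsProbabilityMeasure ν ∧ Integrable X ν ∧ ∫ ω, X ω ∂ν = x ∧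
      ν ≤ P.withDensity fun ω => ENNReal.ofReal (Real.exp (L + θ * (X ω - x))) := by
  obtain ⟨L', hL', hL⟩ := EReal.exists_between_coe_real h
  obtain ⟨ν, θ, hν, hint, hmean, hle⟩ := exists_centered_tilt (hX.sub_const x)
    (EReal.coe_lt_coe_iff.1 hL) (ofReal_exp_neg_le_emgf_sub hX hL'.le)
  have hXint : Integrable X ν :=
    (hint.add (integrable_const x)).congr (ae_of_all _ fun ω => by simp)
  rw [integral_sub hXint (integrable_const x), integral_const, probReal_univ, one_smul,
    sub_eq_zero] at hmean
  exact ⟨ν, θ, hν, hXint, hmean, hle⟩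

end Tilting

/-! ### The joint law of the loss amount and the default time -/

section Grid

variable {N : ℕ}

/-- The measure on pairs of a loss amount and a default time in which `m i` is the part carried by
the `i`-th grid point. -/
noncomputable def gridMixture (m : Fin N → Measure ℝ) : Measure (ℝ × ℕ) :=
  ∑ i, (m i).map fun u => (u, (i : ℕ) + 1)

theorem lintegral_gridMixture (m : Fin N → Measure ℝ) {f : ℝ × ℕ → ℝ≥0∞} (hf : Measurable f) :
    ∫⁻ e, f e ∂gridMixture m = ∑ i, ∫⁻ u, f (u, (i : ℕ) + 1) ∂m i := by
  rw [gridMixture, lintegral_finsetSum_measure]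
  exact Finset.sum_congr rfl fun i _ => lintegral_map hf (by fun_prop)

theorem integrable_gridMixture {m : Fin N → Measure ℝ} {f : ℝ × ℕ → ℝ} (hf : Measurable f)
    (h : ∀ i : Fin N, Integrable (fun u => f (u, (i : ℕ) + 1)) (m i)) :
    Integrable f (gridMixture m) :=
  integrable_finsetSum_measure.2 fun i _ =>
    (integrable_map_measure hf.aestronglyMeasurable (by fun_prop)).2 (h i)

theorem integral_gridMixture {m : Fin N → Measure ℝ} {f : ℝ × ℕ → ℝ} (hf : Measurable f)
    (h : ∀ i : Fin N, Integrable (fun u => f (u, (i : ℕ) + 1)) (m i)) :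
    ∫ e, f e ∂gridMixture m = ∑ i, ∫ u, f (u, (i : ℕ) + 1) ∂m i := by
  rw [gridMixture, integral_finsetSum_measure fun i _ =>
    (integrable_map_measure hf.aestronglyMeasurable (by fun_prop)).2 (h i)]
  exact Finset.sum_congr rfl fun i _ => integral_map (by fun_prop) hf.aestronglyMeasurable

theorem gridMixture_le_withDensity {m m' : Fin N → Measure ℝ} {f : ℝ × ℕ → ℝ≥0∞}
    (hf : Measurable f) (h : ∀ i, m i ≤ (m' i).withDensity fun u => f (u, (i : ℕ) + 1)) :
    gridMixture m ≤ (gridMixture m').withDensity f := by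
  refine Measure.le_iff.2 fun s hs => ?_
  rw [withDensity_apply _ hs, ← lintegral_indicator hs, lintegral_gridMixture _ (hf.indicator hs),
    gridMixture, Measure.finsetSum_apply]
  refine Finset.sum_le_sum fun i _ => ?_
  have hsec : MeasurableSet ((fun u : ℝ => (u, (i : ℕ) + 1)) ⁻¹' s) := measurable_prodMk_right hs
  rw [Measure.map_apply (by fun_prop) hs]
  refine (h i _).trans_eq ?_
  rw [withDensity_apply _ hsec, ← lintegral_indicator hsec]
  rfl

theorem exists_fin_of_mem_Icc {t : ℕ} (h : t ∈ Finset.Icc 1 N) : ∃ i : Fin N, t = (i : ℕ) + 1 := by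
  rw [Finset.mem_Icc] at h
  exact ⟨⟨t - 1, by lia⟩, by simp only; lia⟩

variable {Ω : Type*} [MeasurableSpace Ω] {P : Measure Ω}

theorem map_eq_sum_defaultDist_smul_dirac {T : Ω → ℕ} (hT : Measurable T)
    (hgrid : ∀ᵐ ω ∂P, T ω ∈ Finset.Icc 1 N) :
    P.map T = ∑ i, defaultDist P N T i • Measure.dirac ((i : ℕ) + 1) := by
  refine Measure.ext_of_singleton fun t => ?_
  have hmap : P.map T {t} = P {ω | T ω = t} := Measure.map_apply hT (measurableSet_singleton t)
  rw [hmap, Measure.finsetSum_apply]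
  by_cases ht : t ∈ Finset.Icc 1 N
  · obtain ⟨i, rfl⟩ := exists_fin_of_mem_Icc ht
    have hdirac (j : Fin N) :
        Measure.dirac ((j : ℕ) + 1) {(i : ℕ) + 1} = if j = i then (1 : ℝ≥0∞) else 0 := by
      simp [Set.indicator, Fin.ext_iff]
    simp [hdirac, defaultDist]
  · have hnull : P {ω | T ω = t} = 0 :=
      measure_eq_zero_iff_ae_notMem.2 (hgrid.mono fun ω hω (h : T ω = t) => ht (h ▸ hω))
    rw [hnull, Finset.sum_eq_zero]
    intro i _
    have hi : (i : ℕ) + 1 ≠ t := fun h => ht (h ▸ by simp)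
    simp [hi]

theorem sum_defaultDist [IsProbabilityMeasure P] {T : Ω → ℕ} (hT : Measurable T)
    (hgrid : ∀ᵐ ω ∂P, T ω ∈ Finset.Icc 1 N) : ∑ i, defaultDist P N T i = 1 := by
  have : IsProbabilityMeasure (P.map T) := Measure.isProbabilityMeasure_map hT.aemeasurable
  simpa [map_eq_sum_defaultDist_smul_dirac hT hgrid] using measure_univ (μ := P.map T)

theorem map_prodMk_eq_gridMixture [IsFiniteMeasure P] {X : Ω → ℝ} {T : Ω → ℕ} (hX : Measurable X)
    (hT : Measurable T) (hXT : IndepFun X T P) (hgrid : ∀ᵐ ω ∂P, T ω ∈ Finset.Icc 1 N) :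
    P.map (fun ω => (X ω, T ω)) = gridMixture fun i => defaultDist P N T i • P.map X := by
  rw [(indepFun_iff_map_prod_eq_prod_map_map hX.aemeasurable hT.aemeasurable).1 hXT,
    map_eq_sum_defaultDist_smul_dirac hT hgrid, ← Measure.sum_fintype, Measure.prod_sum_right,
    Measure.sum_fintype, gridMixture]
  exact Finset.sum_congr rfl fun i _ => by
    rw [Measure.prod_smul_right, Measure.prod_dirac, Measure.map_smul]

/-- The indicator of the event that the default time is the `i`-th grid point. -/
def gridInd (i : Fin N) (e : ℝ × ℕ) : ℝ := if e.2 = (i : ℕ) + 1 then 1 else 0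

@[fun_prop]
theorem measurable_gridInd (i : Fin N) : Measurable (gridInd i) :=
  Measurable.ite (measurable_snd (measurableSet_singleton _)) measurable_const measurable_const

theorem gridInd_nonneg (i : Fin N) (e : ℝ × ℕ) : 0 ≤ gridInd i e := by
  unfold gridInd; split_ifs <;> norm_num

theorem gridInd_grid (i j : Fin N) (u : ℝ) :
    gridInd j (u, (i : ℕ) + 1) = if j = i then 1 else 0 := by
  simp [gridInd, Fin.ext_iff, eq_comm]

theorem sum_gridInd_mul_grid (i : Fin N) (u : ℝ) (g : Fin N → ℝ) :
    ∑ j, gridInd j (u, (i : ℕ) + 1) * g j = g i := by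
  simp [gridInd_grid]

theorem sum_gridInd {e : ℝ × ℕ} (he : e.2 ∈ Finset.Icc 1 N) : ∑ i : Fin N, gridInd i e = 1 := by
  obtain ⟨i, hi⟩ := exists_fin_of_mem_Icc he
  rw [show e = (e.1, (i : ℕ) + 1) from Prod.ext rfl hi]
  simpa using sum_gridInd_mul_grid i e.1 fun _ => 1

/-- The function of a loss amount `u` and a default time which equals `η i + θ i * u` at the `i`-th
grid point. -/
def gridAffine (η θ : Fin N → ℝ) (e : ℝ × ℕ) : ℝ := ∑ i, gridInd i e * (η i + θ i * e.1)

theorem measurable_gridAffine (η θ : Fin N → ℝ) : Measurable (gridAffine η θ) := by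
  unfold gridAffine; fun_prop

theorem gridAffine_grid (η θ : Fin N → ℝ) (i : Fin N) (u : ℝ) :
    gridAffine η θ (u, (i : ℕ) + 1) = η i + θ i * u :=
  sum_gridInd_mul_grid i u fun j => η j + θ j * u

theorem lintegral_exp_gridAffine [IsFiniteMeasure P] {X : Ω → ℝ} {T : Ω → ℕ} (hX : Measurable X)
    (hT : Measurable T) (hXT : IndepFun X T P) (hgrid : ∀ᵐ ω ∂P, T ω ∈ Finset.Icc 1 N)
    (η θ : Fin N → ℝ) :
    ∫⁻ ω, ENNReal.ofReal (Real.exp (gridAffine η θ (X ω, T ω))) ∂P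
      = ∑ i, tiltedMass P X (defaultDist P N T i) (η i) (θ i) := by
  have hm : Measurable fun e => ENNReal.ofReal (Real.exp (gridAffine η θ e)) :=
    (measurable_gridAffine η θ).exp.ennreal_ofReal
  rw [← lintegral_map hm (hX.prodMk hT), map_prodMk_eq_gridMixture hX hT hXT hgrid,
    lintegral_gridMixture _ hm]
  refine Finset.sum_congr rfl fun i _ => ?_
  simp only [gridAffine_grid, Real.exp_add, ENNReal.ofReal_mul (Real.exp_pos _).le]
  rw [lintegral_smul_measure, lintegral_const_mul _ (by fun_prop), lintegral_map (by fun_prop) hX,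
    smul_eq_mul, tiltedMass, emgf, mul_assoc]

end Grid

/-! ### Default frequencies and increments of the average loss path -/

section Counting

variable {Ω : Type*} {N : ℕ} {U : ℕ → Ω → ℝ} {τ : ℕ → Ω → ℕ}

/-- The fraction of the first `n` obligors that default at the `i`-th grid point. -/
noncomputable def gridFreq (U : ℕ → Ω → ℝ) (τ : ℕ → Ω → ℕ) (n : ℕ) (ω : Ω) (i : Fin N) : ℝ :=
  (∑ k ∈ Finset.range n, gridInd i (U k ω, τ k ω)) / n

theorem gridFreq_mem_stdSimplex {ω : Ω} (hω : ∀ k, τ k ω ∈ Finset.Icc 1 N) {n : ℕ} (hn : n ≠ 0) :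
    (gridFreq U τ n ω : Fin N → ℝ) ∈ stdSimplex ℝ (Fin N) := by
  refine ⟨fun i => div_nonneg (Finset.sum_nonneg fun k _ => gridInd_nonneg _ _) n.cast_nonneg, ?_⟩
  have hsum (k : ℕ) : ∑ i : Fin N, gridInd i (U k ω, τ k ω) = 1 := sum_gridInd (hω k)
  simp only [gridFreq]
  rw [← Finset.sum_div, Finset.sum_comm]
  simp [hsum, hn]

theorem measurable_gridFreq [MeasurableSpace Ω] (hUm : ∀ k, Measurable (U k))
    (hτm : ∀ k, Measurable (τ k)) (n : ℕ) :
    Measurable (gridFreq U τ n : Ω → Fin N → ℝ) :=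
  measurable_pi_lambda _ fun i => (Finset.measurable_sum _ fun k _ =>
    (measurable_gridInd i).comp ((hUm k).prodMk (hτm k))).div_const _

theorem increment_avgLossPath (hU : ∀ k ω, 0 ≤ U k ω) {ω : Ω}
    (hω : ∀ k, τ k ω ∈ Finset.Icc 1 N) (n : ℕ) (i : Fin N) :
    increment (avgLossPath N U τ hU n ω).1 i
      = (∑ k ∈ Finset.range n, gridInd i (U k ω, τ k ω) * U k ω) / n := by
  have hprev : (if (i : ℕ) = 0 then 0 else (avgLossPath N U τ hU n ω).1
      ⟨(i : ℕ) - 1, lt_of_le_of_lt (Nat.sub_le _ _) i.isLt⟩) = loss U τ n i ω / n := by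
    split_ifs with hi
    · have hpos (k : ℕ) : τ k ω ≠ 0 := Nat.one_le_iff_ne_zero.1 (Finset.mem_Icc.1 (hω k)).1
      simp [hi, loss, hpos]
    · simp only [avgLossPath, Nat.sub_add_cancel (Nat.pos_of_ne_zero hi)]
  rw [increment, hprev]
  simp only [avgLossPath, loss]
  rw [← sub_div, ← Finset.sum_sub_distrib]
  congr 1
  refine Finset.sum_congr rfl fun k _ => ?_
  simp only [gridInd]
  split_ifs <;> first | lia | ring

theorem avgLossPath_le (hU : ∀ k ω, 0 ≤ U k ω) (n : ℕ) (ω : Ω) (i : Fin N) :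
    (avgLossPath N U τ hU n ω).1 i ≤ (∑ k ∈ Finset.range n, U k ω) / n := by
  refine div_le_div_of_nonneg_right (Finset.sum_le_sum fun k _ => ?_) n.cast_nonneg
  exact mul_le_of_le_one_right (hU k ω) (by split_ifs <;> norm_num)

theorem measurable_avgLossPath [MeasurableSpace Ω] (hUm : ∀ k, Measurable (U k))
    (hτm : ∀ k, Measurable (τ k)) (hU : ∀ k ω, 0 ≤ U k ω) (n : ℕ) :
    Measurable (avgLossPath N U τ hU n) := by
  refine Measurable.subtype_mk (measurable_pi_lambda _ fun i => ?_)
  refine Measurable.div_const (Finset.measurable_sum _ fun k _ => (hUm k).mul ?_) _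
  exact Measurable.ite (hτm k measurableSet_Iic) measurable_const measurable_const

theorem sum_mul_average {ι : Type*} [Fintype ι] (c : ι → ℝ) (g : ι → ℕ → ℝ) (n : ℕ) :
    ∑ i, c i * ((∑ k ∈ Finset.range n, g i k) / n)
      = (∑ k ∈ Finset.range n, ∑ i, g i k * c i) / n := by
  rw [Finset.sum_comm, Finset.sum_div]
  exact Finset.sum_congr rfl fun i _ => by rw [← mul_div_assoc, mul_comm, Finset.sum_mul]

theorem dualValue_gridFreq [MeasurableSpace Ω] {P : Measure Ω} {X : Ω → ℝ} {p : Fin N → ℝ≥0∞}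
    {η θ : Fin N → ℝ} (hq : ∀ i, tiltedMass P X (p i) (η i) (θ i) ≠ ⊤)
    (hU : ∀ k ω, 0 ≤ U k ω) {ω : Ω} (hω : ∀ k, τ k ω ∈ Finset.Icc 1 N) {n : ℕ} (hn : n ≠ 0) :
    dualValue P X p η θ (gridFreq U τ n ω) (increment (avgLossPath N U τ hU n ω).1)
      = (∑ k ∈ Finset.range n, gridAffine η θ (U k ω, τ k ω)) / n
        + 1 - (∑ i, tiltedMass P X (p i) (η i) (θ i)).toReal := by
  simp only [dualValue, dualTerm, Finset.sum_sub_distrib, Finset.sum_add_distrib]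
  rw [(gridFreq_mem_stdSimplex hω hn).2, ENNReal.toReal_sum fun i _ => hq i]
  congr 2
  have hloss (i : Fin N) (k : ℕ) : gridInd i (U k ω, τ k ω) * (θ i * U k ω)
      = gridInd i (U k ω, τ k ω) * U k ω * θ i := by ring
  simp only [increment_avgLossPath hU hω, gridFreq, gridAffine, sum_mul_average, mul_add, hloss,
    Finset.sum_add_distrib, add_div]

end Counting

/-! ### The upper bound -/

section UpperBound

open ExpGrowth

variable {Ω : Type*} [MeasurableSpace Ω] {P : Measure Ω} {N : ℕ} {U : ℕ → Ω → ℝ} {τ : ℕ → Ω → ℕ}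

theorem expGrowthSup_lt_dualValue_le [IsFiniteMeasure P] (hUm : ∀ k, Measurable (U k))
    (hτm : ∀ k, Measurable (τ k)) (hU : ∀ k ω, 0 ≤ U k ω)
    (hgrid : ∀ᵐ ω ∂P, ∀ k, τ k ω ∈ Finset.Icc 1 N)
    (hVi : iIndepFun (fun k ω => (U k ω, τ k ω)) P)
    (hVd : ∀ k, IdentDistrib (fun ω => (U k ω, τ k ω)) (fun ω => (U 0 ω, τ 0 ω)) P P)
    (hUτ : IndepFun (U 0) (τ 0) P) {η θ : Fin N → ℝ}
    (hq : ∀ i, tiltedMass P (U 0) (defaultDist P N (τ 0) i) (η i) (θ i) ≠ ⊤) (a : ℝ) :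
    expGrowthSup (fun n => P {ω | a < dualValue P (U 0) (defaultDist P N (τ 0)) η θ
      (gridFreq U τ n ω) (increment (avgLossPath N U τ hU n ω).1)}) ≤ (-a : ℝ) := by
  set Q := ∑ i, tiltedMass P (U 0) (defaultDist P N (τ 0) i) (η i) (θ i)
  have hchernoff := expGrowthSup_measure_le_sum_le (V := fun k ω => (U k ω, τ k ω))
    (fun k => (hUm k).prodMk (hτm k)) hVi hVd (measurable_gridAffine η θ)
    (lintegral_exp_gridAffine (hUm 0) (hτm 0) hUτ (hgrid.mono fun ω h => h 0) η θ)
    (ENNReal.sum_ne_top.2 fun i _ => hq i) (a - 1 + Q.toReal)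
  rw [show Q.toReal - 1 - (a - 1 + Q.toReal) = -a by ring] at hchernoff
  refine (expGrowthSup_eventually_monotone ?_).trans hchernoff
  filter_upwards [eventually_ne_atTop 0] with n hn
  refine measure_mono_ae ?_
  filter_upwards [hgrid] with ω hω h
  have hlt : a < (∑ k ∈ Finset.range n, gridAffine η θ (U k ω, τ k ω)) / n + 1 - Q.toReal :=
    lt_of_lt_of_eq h (dualValue_gridFreq hq hU hω hn)
  have hn0 : (0 : ℝ) < n := Nat.cast_pos.2 (Nat.pos_of_ne_zero hn)
  exact (mul_comm _ _).trans_le ((le_div_iff₀ hn0).1 (by linarith))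

/-- The default frequencies are carried along: the joint law of the path and the frequencies lives
on a compact set, which is covered by finitely many half-spaces `{a < dualValue}`. -/
theorem expGrowthSup_map_avgLossPath_le_of_isCompact [IsProbabilityMeasure P]
    (hUm : ∀ k, Measurable (U k)) (hτm : ∀ k, Measurable (τ k)) (hU : ∀ k ω, 0 ≤ U k ω)
    (hgrid : ∀ᵐ ω ∂P, ∀ k, τ k ω ∈ Finset.Icc 1 N)
    (hVi : iIndepFun (fun k ω => (U k ω, τ k ω)) P)
    (hVd : ∀ k, IdentDistrib (fun ω => (U k ω, τ k ω)) (fun ω => (U 0 ω, τ 0 ω)) P P)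
    (hUτ : IndepFun (U 0) (τ 0) P) (hM : N ≤ 1 ∨ ∀ θ, emgf P (U 0) θ ≠ ⊤)
    {F : Set (PathSpace N)} (hF : IsCompact F) {a : ℝ}
    (ha : ∀ x ∈ F, (a : EReal) < rateFunction P (U 0) (defaultDist P N (τ 0)) x) :
    expGrowthSup (fun n => P.map (avgLossPath N U τ hU n) F) ≤ (-a : ℝ) := by
  set W : ℕ → Ω → PathSpace N × (Fin N → ℝ) := fun n ω =>
    (avgLossPath N U τ hU n ω, gridFreq U τ n ω)
  have hL := measurable_avgLossPath (N := N) hUm hτm hU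
  have hW (n : ℕ) : Measurable (W n) := (hL n).prodMk (measurable_gridFreq hUm hτm n)
  have hcompact := hF.prod (isCompact_stdSimplex ℝ (Fin N))
  have hjoint : expGrowthSup (fun n => P.map (W n) (F ×ˢ stdSimplex ℝ (Fin N))) ≤ (-a : ℝ) := by
    refine expGrowthSup_le_of_isCompact hcompact ?_
    rintro ⟨x, φ⟩ ⟨hx, hφ⟩
    obtain ⟨η, θ, hq, hlt⟩ := exists_lt_dualValue (hUm 0) (fun i => measure_ne_top P _) hφ.1
      (fun i => hM.imp_left fun hN => pos_of_mem_stdSimplex_of_le_one hN hφ i)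
      ((ha x hx).trans_le (iInf₂_le φ hφ))
    set S := {z : PathSpace N × (Fin N → ℝ) |
      a < dualValue P (U 0) (defaultDist P N (τ 0)) η θ z.2 (increment z.1.1)}
    have hS : IsOpen S := isOpen_lt continuous_const (continuous_dualValue_increment _ η θ)
    refine ⟨S, hS.mem_nhds hlt, ?_⟩
    have hmap (n : ℕ) : P.map (W n) S = P (W n ⁻¹' S) :=
      Measure.map_apply (hW n) hS.measurableSet
    exact (congrArg expGrowthSup (funext hmap)).trans_le
      (expGrowthSup_lt_dualValue_le hUm hτm hU hgrid hVi hVd hUτ hq a)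
  refine (expGrowthSup_eventually_monotone ?_).trans hjoint
  filter_upwards [eventually_ne_atTop 0] with n hn
  rw [Measure.map_apply (hL n) hF.measurableSet, Measure.map_apply (hW n) hcompact.measurableSet]
  refine measure_mono_ae ?_
  filter_upwards [hgrid] with ω hω h
  exact ⟨h, gridFreq_mem_stdSimplex hω hn⟩

theorem isCompact_setOf_forall_le (R : ℝ) : IsCompact {x : PathSpace N | ∀ i, x.1 i ≤ R} := by
  have hclosed : IsClosed {x : Fin N → ℝ | (∀ i, 0 ≤ x i) ∧ Monotone x} :=
    isClosed_Ici.inter isClosed_monotone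
  have himage : Subtype.val '' {x : PathSpace N | ∀ i, x.1 i ≤ R}
      = {x : Fin N → ℝ | (∀ i, 0 ≤ x i) ∧ Monotone x} ∩ Set.Icc 0 fun _ => R := by
    ext x
    exact ⟨fun ⟨y, hy, hyx⟩ => hyx ▸ ⟨y.2, y.2.1, hy⟩, fun ⟨hx, hR⟩ => ⟨⟨x, hx⟩, hR.2, rfl⟩⟩
  rw [Subtype.isCompact_iff, himage]
  exact isCompact_Icc.inter_left hclosed

theorem exists_expGrowthSup_compl_setOf_forall_le [IsProbabilityMeasure P]
    (hUm : ∀ k, Measurable (U k)) (hτm : ∀ k, Measurable (τ k)) (hU : ∀ k ω, 0 ≤ U k ω)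
    (hUi : iIndepFun U P) (hUd : ∀ k, IdentDistrib (U k) (U 0) P P) {θ : ℝ} (hθ : 0 < θ)
    (hM : emgf P (U 0) θ ≠ ⊤) (a : ℝ) :
    ∃ R : ℝ, expGrowthSup (fun n => P.map (avgLossPath N U τ hU n) {x | ∀ i, x.1 i ≤ R}ᶜ)
      ≤ (-a : ℝ) := by
  set Q := emgf P (U 0) θ with hQ
  refine ⟨(a - 1 + Q.toReal) / θ, ?_⟩
  have hchernoff := expGrowthSup_measure_le_sum_le hUm hUi hUd (f := fun u => θ * u) (by fun_prop)
    hQ.symm hM (a - 1 + Q.toReal)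
  rw [show Q.toReal - 1 - (a - 1 + Q.toReal) = -a by ring] at hchernoff
  refine (expGrowthSup_eventually_monotone ?_).trans hchernoff
  filter_upwards [eventually_ne_atTop 0] with n hn
  rw [Measure.map_apply (measurable_avgLossPath hUm hτm hU n)
    (isCompact_setOf_forall_le _).measurableSet.compl]
  refine measure_mono fun ω hω => ?_
  obtain ⟨i, hi⟩ : ∃ i, (a - 1 + Q.toReal) / θ < (avgLossPath N U τ hU n ω).1 i := by
    by_contra! h
    exact hω h
  have hn0 : (0 : ℝ) < n := Nat.cast_pos.2 (Nat.pos_of_ne_zero hn)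
  have hmean := (hi.trans_le (avgLossPath_le hU n ω i)).le
  rw [div_le_div_iff₀ hθ hn0, Finset.sum_mul] at hmean
  simpa only [Set.mem_ofPred_eq, mul_comm] using hmean

theorem exists_forall_fenchelLegendre_le [IsProbabilityMeasure P] {X : Ω → ℝ} (hX : Measurable X)
    (h : ∀ θ : ℝ, 0 < θ → emgf P X θ = ⊤) {ε : ℝ} (hε : 0 < ε) :
    ∃ K : ℝ, ∀ x, K ≤ x → fenchelLegendre P X x ≤ ε := by
  have hlt : ENNReal.ofReal (Real.exp (-ε)) < P .univ := by
    simpa using hε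
  obtain ⟨n, hn⟩ :=
    ((tendsto_measure_inter_abs_le P X .univ).eventually (lt_mem_nhds hlt)).exists
  rw [Set.univ_inter] at hn
  refine ⟨n, fun x hx => iSup_le fun θ => ?_⟩
  rcases lt_or_ge 0 θ with hθ | hθ
  · simp [logMGF_eq_log_emgf, h θ hθ]
  have hemgf : ENNReal.ofReal (Real.exp (θ * n - ε)) ≤ emgf P X θ := by
    calc ENNReal.ofReal (Real.exp (θ * n - ε))
        = ENNReal.ofReal (Real.exp (θ * n)) * ENNReal.ofReal (Real.exp (-ε)) := by
          rw [← ENNReal.ofReal_mul (Real.exp_pos _).le, ← Real.exp_add, sub_eq_add_neg]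
      _ ≤ ENNReal.ofReal (Real.exp (θ * n)) * P {ω | |X ω| ≤ n} := by gcongr
      _ = ∫⁻ _ in {ω | |X ω| ≤ n}, ENNReal.ofReal (Real.exp (θ * n)) ∂P :=
          (setLIntegral_const _ _).symm
      _ ≤ ∫⁻ ω in {ω | |X ω| ≤ n}, ENNReal.ofReal (Real.exp (θ * X ω)) ∂P :=
          setLIntegral_mono' (measurableSet_abs_le hX n) fun ω hω => ENNReal.ofReal_le_ofReal <|
            Real.exp_le_exp.2 (mul_le_mul_of_nonpos_left (abs_le.1 hω).2 hθ)
      _ ≤ emgf P X θ := setLIntegral_le_lintegral _ _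
  have hlog : ((θ * n - ε : ℝ) : EReal) ≤ logMGF P X θ := by
    simpa [logMGF_eq_log_emgf, ENNReal.log_ofReal_of_pos (Real.exp_pos _)] using
      ENNReal.log_monotone hemgf
  refine (EReal.sub_le_sub le_rfl hlog).trans ?_
  rw [← EReal.coe_sub, EReal.coe_le_coe_iff]
  linarith [mul_le_mul_of_nonpos_left hx hθ]

theorem rateFunction_le_fenchelLegendre {X : Ω → ℝ} {p : Fin 1 → ℝ≥0∞} (hp : ∑ i, p i = 1)
    (x : PathSpace 1) : rateFunction P X p x ≤ fenchelLegendre P X (x.1 0) := by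
  have hp0 : p 0 = 1 := by simpa using hp
  refine (iInf₂_le (fun _ => 1) ⟨fun _ => zero_le_one, by simp⟩).trans_eq ?_
  simp [rateTerm, hp0, increment]

theorem isCompact_of_forall_lt_rateFunction [IsProbabilityMeasure P] (hN : N ≤ 1) {X : Ω → ℝ}
    (hX : Measurable X) (hM : ∀ θ : ℝ, 0 < θ → emgf P X θ = ⊤) {p : Fin N → ℝ≥0∞}
    (hp : ∑ i, p i = 1) {F : Set (PathSpace N)} (hF : IsClosed F) {a : ℝ} (ha : 0 < a)
    (h : ∀ x ∈ F, (a : EReal) < rateFunction P X p x) : IsCompact F := by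
  obtain ⟨K, hK⟩ := exists_forall_fenchelLegendre_le hX hM ha
  refine (isCompact_setOf_forall_le K).of_isClosed_subset hF fun x hx i => ?_
  obtain rfl : N = 1 := by have := i.isLt; lia
  by_contra! hi
  rw [Subsingleton.elim i 0] at hi
  exact (h x hx).not_ge ((rateFunction_le_fenchelLegendre hp x).trans (hK _ hi.le))

theorem expGrowthSup_map_avgLossPath_le [IsProbabilityMeasure P]
    (hUm : ∀ k, Measurable (U k)) (hτm : ∀ k, Measurable (τ k)) (hU : ∀ k ω, 0 ≤ U k ω)
    (hgrid : ∀ᵐ ω ∂P, ∀ k, τ k ω ∈ Finset.Icc 1 N)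
    (hVi : iIndepFun (fun k ω => (U k ω, τ k ω)) P)
    (hVd : ∀ k, IdentDistrib (fun ω => (U k ω, τ k ω)) (fun ω => (U 0 ω, τ 0 ω)) P P)
    (hUτ : IndepFun (U 0) (τ 0) P) (hM : N ≤ 1 ∨ ∀ θ, emgf P (U 0) θ ≠ ⊤)
    {F : Set (PathSpace N)} (hF : IsClosed F) :
    expGrowthSup (fun n => P.map (avgLossPath N U τ hU n) F)
      ≤ -⨅ x ∈ F, rateFunction P (U 0) (defaultDist P N (τ 0)) x := by
  have hL := measurable_avgLossPath (N := N) hUm hτm hU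
  rw [EReal.le_neg]
  refine EReal.ge_of_forall_gt_iff_ge.1 fun a ha => ?_
  rw [EReal.le_neg, ← EReal.coe_neg]
  have hcompact {S : Set (PathSpace N)} (hS : IsCompact S) (hSF : S ⊆ F) :
      expGrowthSup (fun n => P.map (avgLossPath N U τ hU n) S) ≤ (-a : ℝ) :=
    expGrowthSup_map_avgLossPath_le_of_isCompact hUm hτm hU hgrid hVi hVd hUτ hM hS
      fun x hx => ha.trans_le (iInf₂_le x (hSF hx))
  by_cases hθ : ∃ θ : ℝ, 0 < θ ∧ emgf P (U 0) θ ≠ ⊤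
  · obtain ⟨θ, hθ, hMθ⟩ := hθ
    obtain ⟨R, hR⟩ := exists_expGrowthSup_compl_setOf_forall_le (N := N) hUm hτm hU
      (hVi.comp (fun _ => Prod.fst) fun _ => measurable_fst)
      (fun k => (hVd k).comp measurable_fst) hθ hMθ a
    have hinter := hcompact ((isCompact_setOf_forall_le R).inter_left hF) Set.inter_subset_left
    refine le_trans (expGrowthSup_monotone fun n => ?_)
      (expGrowthSup_add.trans_le (max_le hinter hR))
    exact (measure_mono fun x hx => (em (∀ i, x.1 i ≤ R)).imp_left (And.intro hx)).trans
      (measure_union_le _ _)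
  push Not at hθ
  rcases lt_or_ge a 0 with ha0 | ha0
  · have (n : ℕ) : IsProbabilityMeasure (P.map (avgLossPath N U τ hU n)) :=
      Measure.isProbabilityMeasure_map (hL n).aemeasurable
    have hgrowth : expGrowthSup (fun n => P.map (avgLossPath N U τ hU n) F) ≤ 0 :=
      (expGrowthSup_monotone fun n => prob_le_one).trans_eq
        (expGrowthSup_const one_ne_zero ENNReal.one_ne_top)
    exact hgrowth.trans (EReal.coe_nonneg.2 (neg_nonneg.2 ha0.le))
  · obtain ⟨b, hab, hb⟩ := EReal.exists_between_coe_real ha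
    refine hcompact (isCompact_of_forall_lt_rateFunction ?_ (hUm 0) hθ
      (sum_defaultDist (hτm 0) (hgrid.mono fun ω h => h 0)) hF
      (ha0.trans_lt (EReal.coe_lt_coe_iff.1 hab))
        fun x hx => hb.trans_le (iInf₂_le x hx)) subset_rfl
    exact hM.resolve_right fun h => h 1 (hθ 1 one_pos)

end UpperBound

/-! ### The lower bound -/

section LowerBound

open ExpGrowth

variable {Ω : Type*} [MeasurableSpace Ω] {P : Measure Ω} {N : ℕ}

theorem fenchelLegendre_map {X : Ω → ℝ} (hX : Measurable X) :
    fenchelLegendre (P.map X) (fun u => u) = fenchelLegendre P X := by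
  ext x
  have hlogMGF (θ : ℝ) : logMGF (P.map X) (fun u => u) θ = logMGF P X θ := by
    simp only [logMGF]
    rw [lintegral_map (by fun_prop) hX]
  simp only [fenchelLegendre, hlogMGF]

theorem exists_measure_of_rateTerm_lt_of_pos [IsProbabilityMeasure P] {X : Ω → ℝ}
    (hX : Measurable X) {p : ℝ≥0∞} (hp : p ≠ ⊤) (hp0 : p ≠ 0) {φ d r : ℝ} (hφ : 0 < φ)
    (h : rateTerm (fenchelLegendre P X) p φ d < r) :
    ∃ (m : Measure ℝ) (b θ : ℝ), m .univ = ENNReal.ofReal φ ∧ Integrable (fun u => u) m ∧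
      ∫ u, u ∂m = d ∧
      m ≤ (p • P.map X).withDensity (fun u => ENNReal.ofReal (Real.exp (b + θ * u))) ∧
      b * φ + θ * d = r := by
  have : IsProbabilityMeasure (P.map X) := Measure.isProbabilityMeasure_map hX.aemeasurable
  rw [rateTerm_of_pos _ hp hp0 hφ, mul_add_lt_coe_iff hφ, ← fenchelLegendre_map hX] at h
  obtain ⟨ν, θ, hν, hint, hmean, hle⟩ := exists_tilt (X := fun u : ℝ => u) measurable_id h
  set l := Real.log (φ / p.toReal)
  have hmass : ENNReal.ofReal φ = p * ENNReal.ofReal (Real.exp l) := by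
    have hp' := ENNReal.toReal_pos hp0 hp
    rw [Real.exp_log (div_pos hφ hp'), ENNReal.ofReal_div_of_pos hp', ENNReal.ofReal_toReal hp,
      ENNReal.mul_div_cancel hp0 hp]
  refine ⟨ENNReal.ofReal φ • ν, l + (r / φ - l) - θ * (d / φ), θ, by simp,
    hint.smul_measure ENNReal.ofReal_ne_top, ?_, ?_, by field_simp; ring⟩
  · rw [integral_smul_measure, hmean, ENNReal.toReal_ofReal hφ.le, smul_eq_mul,
      mul_div_cancel₀ d hφ.ne']
  calc ENNReal.ofReal φ • ν
      ≤ ENNReal.ofReal φ • (P.map X).withDensity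
          (fun u => ENNReal.ofReal (Real.exp (r / φ - l + θ * (u - d / φ)))) := by gcongr
    _ = (p • P.map X).withDensity
          (fun u => ENNReal.ofReal (Real.exp (l + (r / φ - l) - θ * (d / φ) + θ * u))) := by
        rw [hmass, mul_smul, ← withDensity_smul _ (by fun_prop), withDensity_smul_measure]
        congr 2
        ext u
        rw [Pi.smul_apply, smul_eq_mul, ← ENNReal.ofReal_mul (Real.exp_pos _).le, ← Real.exp_add]
        ring_nf

theorem exists_measure_of_rateTerm_lt [IsProbabilityMeasure P] {X : Ω → ℝ} (hX : Measurable X)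
    {p : ℝ≥0∞} (hp : p ≠ ⊤) {φ d r : ℝ} (hφ : 0 ≤ φ)
    (h : rateTerm (fenchelLegendre P X) p φ d < r) :
    ∃ (m : Measure ℝ) (b θ : ℝ), m .univ = ENNReal.ofReal φ ∧ Integrable (fun u => u) m ∧
      ∫ u, u ∂m = d ∧
      m ≤ (p • P.map X).withDensity (fun u => ENNReal.ofReal (Real.exp (b + θ * u))) ∧
      b * φ + θ * d ≤ r := by
  rcases hφ.eq_or_lt with rfl | hφ
  · obtain rfl : d = 0 := by
      by_contra hd
      simp [rateTerm, hd] at h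
    have hr : 0 < r := by simpa [rateTerm] using h
    exact ⟨0, 0, 0, by simp, integrable_zero_measure, by simp, Measure.zero_le _,
      by simpa using hr.le⟩
  rcases eq_or_ne p 0 with rfl | hp0
  · simp [rateTerm_zero_left hφ] at h
  obtain ⟨m, b, θ, hmass, hint, hmean, hle, heq⟩ :=
    exists_measure_of_rateTerm_lt_of_pos hX hp hp0 hφ h
  exact ⟨m, b, θ, hmass, hint, hmean, hle, heq.le⟩

theorem gridAffine_zero_single (i : Fin N) (e : ℝ × ℕ) :
    gridAffine 0 (Pi.single i 1) e = gridInd i e * e.1 := by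
  simp [gridAffine, Pi.single_apply]

section

variable {m : Fin N → Measure ℝ} [∀ i, IsFiniteMeasure (m i)]
  (hm : ∀ i, Integrable (fun u => u) (m i)) (η θ : Fin N → ℝ)

include hm

theorem integrable_gridAffine : Integrable (gridAffine η θ) (gridMixture m) := by
  refine integrable_gridMixture (measurable_gridAffine η θ) fun i => ?_
  simp only [gridAffine_grid]
  exact (integrable_const (η i)).add ((hm i).const_mul (θ i))

theorem integral_gridAffine :
    ∫ e, gridAffine η θ e ∂gridMixture m
      = ∑ i, (η i * (m i).real .univ + θ i * ∫ u, u ∂m i) := by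
  rw [integral_gridMixture (measurable_gridAffine η θ) fun i => ?_]
  · refine Finset.sum_congr rfl fun i _ => ?_
    simp only [gridAffine_grid]
    rw [integral_add (integrable_const (η i)) ((hm i).const_mul (θ i)), integral_const,
      integral_const_mul, smul_eq_mul, mul_comm (η i)]
  · simp only [gridAffine_grid]
    exact (integrable_const (η i)).add ((hm i).const_mul (θ i))

theorem integral_gridInd_mul (i : Fin N) :
    ∫ e, gridInd i e * e.1 ∂gridMixture m = ∫ u, u ∂m i := by
  simp only [← gridAffine_zero_single, integral_gridAffine hm]
  simp [Pi.single_apply]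

end

variable {U : ℕ → Ω → ℝ} {τ : ℕ → Ω → ℕ}

theorem neg_le_expGrowthInf_increment_near [IsProbabilityMeasure P]
    (hUm : ∀ k, Measurable (U k)) (hτm : ∀ k, Measurable (τ k))
    (hgrid : ∀ᵐ ω ∂P, ∀ k, τ k ω ∈ Finset.Icc 1 N)
    (hVi : iIndepFun (fun k ω => (U k ω, τ k ω)) P)
    (hVd : ∀ k, IdentDistrib (fun ω => (U k ω, τ k ω)) (fun ω => (U 0 ω, τ 0 ω)) P P)
    (hUτ : IndepFun (U 0) (τ 0) P) {φ d : Fin N → ℝ} (hφ : φ ∈ stdSimplex ℝ (Fin N)) {a : ℝ}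
    (h : ∑ i, rateTerm (fenchelLegendre P (U 0)) (defaultDist P N (τ 0) i) (φ i) (d i) < a)
    {δ : ℝ} (hδ : 0 < δ) :
    (-a : ℝ) ≤ expGrowthInf fun n : ℕ => P {ω | ∀ i : Fin N,
      |(∑ k ∈ Finset.range n, gridInd i (U k ω, τ k ω) * U k ω) / n - d i| < δ} := by
  have hp (i : Fin N) : defaultDist P N (τ 0) i ≠ ⊤ := measure_ne_top P _
  obtain ⟨r, hr, hra⟩ :=
    exists_lt_coe_of_sum_lt_coe (fun i => rateTerm_ne_bot (hUm 0) (hp i) (hφ.1 i) _) h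
  choose m b θ hmass hint hmean hle hcost using fun i =>
    exists_measure_of_rateTerm_lt (hUm 0) (hp i) (hφ.1 i) (hr i)
  have hfinite (i : Fin N) : IsFiniteMeasure (m i) := ⟨(hmass i).trans_lt ENNReal.ofReal_lt_top⟩
  have hν : IsProbabilityMeasure (gridMixture m) := ⟨by
    rw [← lintegral_one, lintegral_gridMixture m measurable_const]
    simp [hmass, ← ENNReal.ofReal_sum_of_nonneg fun i _ => hφ.1 i, hφ.2]⟩
  have hdensity : gridMixture m ≤ (P.map fun ω => (U 0 ω, τ 0 ω)).withDensity
      fun e => ENNReal.ofReal (Real.exp (gridAffine b θ e)) := by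
    rw [map_prodMk_eq_gridMixture (hUm 0) (hτm 0) hUτ (hgrid.mono fun ω h => h 0)]
    refine gridMixture_le_withDensity (measurable_gridAffine b θ).exp.ennreal_ofReal fun i => ?_
    simpa only [gridAffine_grid] using hle i
  have hentropy : ∫ e, gridAffine b θ e ∂gridMixture m ≤ a := by
    rw [integral_gridAffine hint]
    simp only [measureReal_def, hmass, ENNReal.toReal_ofReal (hφ.1 _), hmean]
    exact (Finset.sum_le_sum fun i _ => hcost i).trans hra.le
  have hcramer := neg_integral_le_expGrowthInf (fun k => (hUm k).prodMk (hτm k)) hVi hVd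
    (measurable_gridAffine b θ) (integrable_gridAffine hint b θ) hdensity
    (fun i => measurable_gridAffine 0 (Pi.single i 1))
    (fun i => integrable_gridAffine hint 0 (Pi.single i 1)) hδ
  simp only [gridAffine_zero_single, integral_gridInd_mul hint, hmean] at hcramer
  exact (EReal.coe_le_coe_iff.2 (neg_le_neg hentropy)).trans hcramer

theorem abs_sub_lt_of_increment {x y : Fin N → ℝ} {δ : ℝ}
    (h : ∀ i, |increment y i - increment x i| < δ) (i : Fin N) :
    |y i - x i| < ((i : ℕ) + 1) * δ := by
  obtain ⟨m, hm⟩ := i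
  induction m with
  | zero => simpa [increment] using h ⟨0, hm⟩
  | succ m ih =>
    have hstep : increment y ⟨m + 1, hm⟩ - increment x ⟨m + 1, hm⟩
        = (y ⟨m + 1, hm⟩ - x ⟨m + 1, hm⟩) - (y ⟨m, by lia⟩ - x ⟨m, by lia⟩) := by
      simp only [increment, Nat.add_eq_zero_iff, one_ne_zero, and_false, if_false,
        Nat.add_sub_cancel]
      ring
    have hlast := (abs_sub_abs_le_abs_sub _ _).trans_lt (hstep ▸ h ⟨m + 1, hm⟩)
    have hprev := ih (by lia)
    push_cast
    linarith

theorem neg_iInf_rateFunction_le_expGrowthInf [IsProbabilityMeasure P]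
    (hUm : ∀ k, Measurable (U k)) (hτm : ∀ k, Measurable (τ k)) (hU : ∀ k ω, 0 ≤ U k ω)
    (hgrid : ∀ᵐ ω ∂P, ∀ k, τ k ω ∈ Finset.Icc 1 N)
    (hVi : iIndepFun (fun k ω => (U k ω, τ k ω)) P)
    (hVd : ∀ k, IdentDistrib (fun ω => (U k ω, τ k ω)) (fun ω => (U 0 ω, τ 0 ω)) P P)
    (hUτ : IndepFun (U 0) (τ 0) P) {G : Set (PathSpace N)} (hG : IsOpen G) :
    -⨅ x ∈ G, rateFunction P (U 0) (defaultDist P N (τ 0)) x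
      ≤ expGrowthInf fun n => P.map (avgLossPath N U τ hU n) G := by
  rw [EReal.neg_le]
  refine le_iInf₂ fun x hx => le_iInf₂ fun φ hφ => EReal.le_of_forall_lt_iff_le.1 fun a ha => ?_
  rw [EReal.neg_le]
  obtain ⟨ε, hε, hball⟩ := Metric.isOpen_iff.1 hG x hx
  have hN : (0 : ℝ) < N + 1 := by positivity
  refine (neg_le_expGrowthInf_increment_near hUm hτm hgrid hVi hVd hUτ hφ ha
    (div_pos hε hN)).trans (expGrowthInf_monotone fun n => ?_)
  rw [Measure.map_apply (measurable_avgLossPath hUm hτm hU n) hG.measurableSet]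
  refine measure_mono_ae ?_
  filter_upwards [hgrid] with ω hω h
  refine hball ?_
  rw [Metric.mem_ball, Subtype.dist_eq, dist_pi_lt_iff hε]
  intro i
  have hdist := abs_sub_lt_of_increment (x := x.1) (y := (avgLossPath N U τ hU n ω).1)
    (fun j => by rw [increment_avgLossPath hU hω]; exact h j) i
  have hi : ((i : ℕ) : ℝ) + 1 ≤ N + 1 := by gcongr; exact i.isLt.le
  calc dist ((avgLossPath N U τ hU n ω).1 i) (x.1 i)
      < ((i : ℕ) + 1) * (ε / (N + 1)) := hdist
    _ ≤ (N + 1) * (ε / (N + 1)) := by gcongr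
    _ = ε := mul_div_cancel₀ ε hN.ne'

end LowerBound

/-! ### Exponential moments from exponential equivalence -/

section Moments

open ExpGrowth

theorem tsum_ne_top_of_eventually_le {f g : ℕ → ℝ≥0∞} (hf : ∀ n, f n ≠ ⊤)
    (hg : ∑' n, g n ≠ ⊤) (h : ∀ᶠ n in atTop, f n ≤ g n) : ∑' n, f n ≠ ⊤ := by
  obtain ⟨m, hm⟩ := eventually_atTop.1 h
  rw [← ENNReal.summable.sum_add_tsum_nat_add' (k := m)]
  refine ENNReal.add_ne_top.2 ⟨ENNReal.sum_ne_top.2 fun n _ => hf n, ne_top_of_le_ne_top hg ?_⟩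
  calc ∑' n, f (n + m) ≤ ∑' n, g (n + m) := ENNReal.tsum_le_tsum fun n => hm _ (by lia)
    _ ≤ ∑' n, g n := ENNReal.tsum_comp_le_tsum_of_injective (add_left_injective m) g

variable {Ω : Type*} [MeasurableSpace Ω] {P : Measure Ω} {N : ℕ}

theorem emgf_le_tsum {X : Ω → ℝ} (hX : Measurable X) (hX0 : ∀ ω, 0 ≤ X ω) (θ : ℝ) :
    emgf P X θ
      ≤ ∑' n : ℕ, ENNReal.ofReal (Real.exp (|θ| * (n + 1))) * P {ω | (n : ℝ) ≤ X ω} := by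
  have hmeas (n : ℕ) : MeasurableSet {ω | (n : ℝ) ≤ X ω} := measurableSet_le measurable_const hX
  calc emgf P X θ
      ≤ ∫⁻ ω, ∑' n : ℕ, {ω | (n : ℝ) ≤ X ω}.indicator
          (fun _ => ENNReal.ofReal (Real.exp (|θ| * (n + 1)))) ω ∂P := by
        refine lintegral_mono fun ω => le_trans ?_ (ENNReal.le_tsum ⌊X ω⌋₊)
        rw [Set.indicator_of_mem (show ω ∈ {ω' | (⌊X ω⌋₊ : ℝ) ≤ X ω'} from Nat.floor_le (hX0 ω))]
        gcongr
        exacts [hX0 ω, le_abs_self θ, (Nat.lt_floor_add_one _).le]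
    _ = ∑' n : ℕ, ENNReal.ofReal (Real.exp (|θ| * (n + 1))) * P {ω | (n : ℝ) ≤ X ω} := by
        rw [lintegral_tsum fun n => (measurable_const.indicator (hmeas n)).aemeasurable]
        exact tsum_congr fun n => lintegral_indicator_const (hmeas n) _

theorem emgf_ne_top_of_expGrowthSup_eq_bot [IsFiniteMeasure P] {X : Ω → ℝ} (hX : Measurable X)
    (hX0 : ∀ ω, 0 ≤ X ω) (h : expGrowthSup (fun n : ℕ => P {ω | (n : ℝ) ≤ X ω}) = ⊥) (θ : ℝ) :
    emgf P X θ ≠ ⊤ := by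
  have hlt : ENNReal.ofReal (Real.exp (-1)) < 1 := by simp
  have hgeom : ∑' n : ℕ, ENNReal.ofReal (Real.exp |θ|) * ENNReal.ofReal (Real.exp (-1)) ^ n
      ≠ ⊤ := by
    rw [ENNReal.tsum_mul_left, ENNReal.tsum_geometric]
    exact ENNReal.mul_ne_top ENNReal.ofReal_ne_top
      (ENNReal.inv_ne_top.2 (tsub_pos_of_lt hlt).ne')
  refine ne_top_of_le_ne_top (tsum_ne_top_of_eventually_le (fun n => ENNReal.mul_ne_top
    ENNReal.ofReal_ne_top (measure_ne_top P _)) hgeom ?_) (emgf_le_tsum hX hX0 θ)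
  have htail := eventually_le_exp (h.trans_lt (EReal.bot_lt_coe (-(|θ| + 1))))
  filter_upwards [htail] with n hn
  rw [← ofReal_exp_mul_natCast] at hn
  refine (mul_le_mul_right hn _).trans_eq ?_
  rw [← ENNReal.ofReal_pow (Real.exp_pos _).le, ← Real.exp_nat_mul,
    ← ENNReal.ofReal_mul (Real.exp_pos _).le, ← ENNReal.ofReal_mul (Real.exp_pos _).le,
    ← Real.exp_add, ← Real.exp_add]
  ring_nf

theorem map_snd_le_measure_le_dist {ι : Type*} [Fintype ι] {γ : Measure ((ι → ℝ) × (ι → ℝ))}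
    {i : ι} (h : ∀ᵐ v ∂γ.map Prod.fst, v i = 0) (c : ℝ) :
    γ.map Prod.snd {v | c ≤ v i} ≤ γ {z | c ≤ dist z.1 z.2} := by
  rw [Measure.map_apply measurable_snd (measurableSet_le measurable_const (measurable_pi_apply i))]
  refine measure_mono_ae ?_
  filter_upwards [ae_of_ae_map measurable_fst.aemeasurable h] with z hz (hc : c ≤ z.2 i)
  calc c ≤ dist (z.1 i) (z.2 i) := by
        rw [hz, dist_zero_left]
        exact hc.trans (le_abs_self _)
    _ ≤ dist z.1 z.2 := dist_le_pi_dist _ _ i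

variable {U : ℕ → Ω → ℝ}

theorem measurable_roundedSums (hUm : ∀ k, Measurable (U k)) (φ : Fin N → ℝ) (n : ℕ) :
    Measurable (roundedSums U φ n) :=
  measurable_pi_lambda _ fun _ => (Finset.measurable_sum _ fun k _ => hUm k).div_const _

theorem roundedSums_zero {Ω : Type*} [NeZero N] (U : ℕ → Ω → ℝ) (φ : Fin N → ℝ) (n : ℕ)
    (ω : Ω) :
    roundedSums U φ n ω 0 = (∑ k ∈ Finset.range ⌊n * φ 0⌋₊, U k ω) / n := by
  have hIic : Finset.Iic (0 : Fin N) = {0} := by ext j; simp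
  rw [roundedSums, cumul, hIic, Finset.sum_singleton]

/-- Moving the mass `1 / n` to the first grid point changes the first rounded sum from `0` to
`U 0 / n`, so exponential equivalence makes the tail of `U 0` superexponentially small. -/
theorem expGrowthSup_tail_eq_bot (hN : 2 ≤ N) (hUm : ∀ k, Measurable (U k))
    (hexp : RoundedSumsExpEquivalent P N U) :
    expGrowthSup (fun n : ℕ => P {ω | (n : ℝ) ≤ U 0 ω}) = ⊥ := by
  obtain ⟨M, rfl⟩ := Nat.exists_eq_add_of_le' hN
  set path : ℝ → Fin (M + 2) → ℝ := fun t => AffineMap.lineMap (Pi.single 1 1) (Pi.single 0 1) t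
  have hpath {t : ℝ} (ht : t ∈ Set.Icc 0 1) : path t ∈ stdSimplex ℝ (Fin (M + 2)) :=
    (convex_stdSimplex ℝ _).lineMap_mem (single_mem_stdSimplex ℝ 1) (single_mem_stdSimplex ℝ 0) ht
  have hpath0 (t : ℝ) : path t 0 = t := by simp [path, AffineMap.lineMap_apply]
  have hlim : Tendsto (fun n : ℕ => path (n : ℝ)⁻¹) atTop (𝓝 (path 0)) :=
    (AffineMap.lineMap_continuous.tendsto 0).comp tendsto_inv_atTop_nhds_zero_nat
  obtain ⟨γ, hfst, hsnd, hγ⟩ := hexp (path 0) (hpath ⟨le_rfl, zero_le_one⟩) _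
    (fun n => hpath ⟨by positivity, Nat.cast_inv_le_one n⟩) hlim
  rw [← le_bot_iff, ← hγ 1 one_pos]
  refine expGrowthSup_eventually_monotone ?_
  filter_upwards [eventually_gt_atTop 0] with n hn
  have hn' : (0 : ℝ) < n := Nat.cast_pos.2 hn
  have hzero : ∀ᵐ v ∂(γ n).map Prod.fst, v 0 = 0 := by
    rw [hfst, ae_map_iff (measurable_roundedSums hUm _ n).aemeasurable
      (measurableSet_eq_fun (measurable_pi_apply 0) measurable_const)]
    simp [roundedSums_zero, hpath0]
  have htail : P {ω | (n : ℝ) ≤ U 0 ω} = (γ n).map Prod.snd {v | 1 ≤ v 0} := by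
    rw [hsnd, Measure.map_apply (measurable_roundedSums hUm _ n)
      (measurableSet_le measurable_const (measurable_pi_apply 0))]
    simp [roundedSums_zero, hpath0, hn'.ne', one_le_div hn']
  exact htail.trans_le (map_snd_le_measure_le_dist hzero 1)

end Moments

end LossLDP

open LossLDP

theorem theorem3p1 {Ω : Type*} [MeasurableSpace Ω] (P : Measure Ω) [IsProbabilityMeasure P]
    (N : ℕ) (U : ℕ → Ω → ℝ) (τ : ℕ → Ω → ℕ)
    (hU_meas : ∀ k, Measurable (U k)) (hτ_meas : ∀ k, Measurable (τ k))
    (hU_nonneg : ∀ k ω, 0 ≤ U k ω)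
    (hτ_grid : ∀ k, ∀ᵐ ω ∂P, τ k ω ∈ Finset.Icc 1 N)
    (hU_indep : iIndepFun U P) (hU_ident : ∀ k, IdentDistrib (U k) (U 0) P P)
    (hτ_indep : iIndepFun τ P) (hτ_ident : ∀ k, IdentDistrib (τ k) (τ 0) P P)
    (hUτ_indep : IndepFun (fun ω k => U k ω) (fun ω k => τ k ω) P)
    (hexp : LossLDP.RoundedSumsExpEquivalent P N U) :
    LossLDP.SatisfiesLDP
      (fun n => P.map (LossLDP.avgLossPath N U τ hU_nonneg n))
      (LossLDP.rateFunction P (U 0) (LossLDP.defaultDist P N (τ 0))) := by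
  have hgrid : ∀ᵐ ω ∂P, ∀ k, τ k ω ∈ Finset.Icc 1 N := ae_all_iff.2 hτ_grid
  have hUτ (k : ℕ) : IndepFun (U k) (τ k) P :=
    hUτ_indep.comp (measurable_pi_apply k) (measurable_pi_apply k)
  have hVi := iIndepFun_prodMk hU_meas hτ_meas hU_indep hτ_indep hUτ_indep
  have hVd (k : ℕ) : IdentDistrib (fun ω => (U k ω, τ k ω)) (fun ω => (U 0 ω, τ 0 ω)) P P :=
    (hU_ident k).prodMk (hτ_ident k) (hUτ k) (hUτ 0)
  have hM : N ≤ 1 ∨ ∀ θ, emgf P (U 0) θ ≠ ⊤ := (le_or_gt N 1).imp_right fun hN =>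
    emgf_ne_top_of_expGrowthSup_eq_bot (hU_meas 0) (hU_nonneg 0)
      (expGrowthSup_tail_eq_bot hN hU_meas hexp)
  exact
    ⟨⟨rateFunction_nonneg (hU_meas 0) (sum_defaultDist (hτ_meas 0) (hτ_grid 0)),
      lowerSemicontinuous_rateFunction (hU_meas 0) (fun _ => measure_ne_top P _) hM⟩,
    fun _ hF => expGrowthSup_map_avgLossPath_le hU_meas hτ_meas hU_nonneg hgrid hVi hVd (hUτ 0)
      hM hF,
    fun _ hG => neg_iInf_rateFunction_le_expGrowthInf hU_meas hτ_meas hU_nonneg hgrid hVi hVd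
      (hUτ 0) hG⟩
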